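/- **Setting.** Let $L_{TC^0}$ be the first-order language with equality, the relation symbol $\le$, and function symbols for all functions of uniform $TC^0$. Concretely, take the least class of symbols that contains $0$, $1$, $+$, $\cdot$, $x\mathbin{\dot-}y$, $\lfloor x/2\rfloor$, $|x|$ (length in binary), $x\#y=2^{|x||y|}$, $\lfloor x/2^y\rfloor$ and the projections, and is closed under composition and under the following three operations, which produce from $f(i,\vec p)$ functions of $(b,\vec p)$: the number whose $i$-th bit is $1$ iff $i<|b|$ and $f(i,\vec p)\ne0$ (bit comprehension); the least $i<|b|$ with $f(i,\vec p)\ne0$, or $|b|$ if there is none (sharply bounded minimization); and the number of $i<|b|$ with $f(i,\vec p)\ne0$ (counting). Let $BTC^0$ be the universal theory in $L_{TC^0}$ whose axioms are Buss's $BASIC$, associativity of multiplication, the defining axioms $y\le x\to(x\mathbin{\dot-}y)+y=x$, $x\le y\to x\mathbin{\dot-}y=0$, $\lfloor x/2^0\rfloor=x$, $\lfloor x/2^{y+1}\rfloor=\lfloor\lfloor x/2^y\rfloor/2\rfloor$, $|x|\le y\to\lfloor x/2^y\rfloor=0$, and the defining axioms of projections, composition, bit comprehension, minimization and counting (the last by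 recursion: $0$ for $b=0$; the value at $b\ne0$ is the value at $\lfloor b/2\rfloor$, plus $1$ if $f(|\lfloor b/2\rfloor|,\vec p)\ne0$). This is the basic first-order theory for $TC^0$. We write $T\vdash\varphi$ if the sentence $\varphi$ is a first-order consequence of the theory $T$. A formula is *sharply bounded* if it is built from atomic formulas by propositional connectives and quantifiers $\exists x\le|t|$, $\forall x\le|t|$, where $t$ is a term not containing $x$. Let $\hat\Sigma_0=\hat\Pi_0$ be the class of sharply bounded formulas of $L_{TC^0}$. For $i>0$, a $\hat\Sigma_i$ (resp. $\hat\Pi_i$) formula consists of $i$ alternating, possibly empty, blocks of bounded quantifiers $\exists x\le t$, $\forall x\le t$, the first block being existential (resp. universal), followed by a sharply bounded formula. A *rule* is a set of instances $\Delta\,/\,\varphi$, where $\Delta$ is a finite set of sentences and $\varphi$ is a sentence; an axiom scheme is a rule all of whose instances have $\Delta=\varnothing$. For a theory $T$ and a rule $R$, let $[T,R]$ be the set of consequences of $T\cup\{\varphi : \Delta/\varphi\in R,\ T\vdash\psi\text{ for all }\psi\in\Delta\}$. We write $R\le S$ if $[T,R]\subseteq[T,S]$ for every theory $T\supseteq BTC^0$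 in the language $L_{TC^0}$, and $R\equiv S$ if $R\le S$ and $S\le R$. For a class $\Gamma$ of formulas, $\Gamma\text{-}IND$ and $\Gamma\text{-}PIND$ are the schemes consisting of the universal closures of, respectively, $$\varphi(0,\vec y)\land\forall x\,(\varphi(x,\vec y)\to\varphi(x+1,\vec y))\to\forall x\,\varphi(x,\vec y),$$ $$\varphi(0,\vec y)\land\forall x\,(\varphi(\lfloor x/2\rfloor,\vec y)\to\varphi(x,\vec y))\to\forall x\,\varphi(x,\vec y)$$ for $\varphi(x,\vec y)\in\Gamma$, where $\vec y$ is any finite tuple of parameters. The parameter-free schemes $\Gamma\text{-}IND^-$ and $\Gamma\text{-}PIND^-$ consist of the instances in which $\vec y$ is empty. The rules $\Gamma\text{-}IND^R$ and $\Gamma\text{-}PIND^R$ have the instances (all sentences being universally closed) $$\frac{\varphi(0,\vec y)\qquad\varphi(x,\vec y)\to\varphi(x+1,\vec y)}{\varphi(x,\vec y)},\qquad \frac{\varphi(0,\vec y)\qquad\varphi(\lfloor x/2\rfloor,\vec y)\to\varphi(x,\vec y)}{\varphi(x,\vec y)}$$ for $\varphi(x,\vec y)\in\Gamma$. **Theorem.**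 Let $i\ge0$, and let $\Gamma$ be $\hat\Sigma_i$ or $\hat\Pi_i$. In statements with $(P)IND$, read either $IND$ throughout or $PIND$ throughout. 1. $\Gamma\text{-}(P)IND^R\le\Gamma\text{-}(P)IND^-\le\Gamma\text{-}(P)IND$. 2. $\hat\Sigma_i\text{-}(P)IND\equiv\hat\Pi_i\text{-}(P)IND$. 3. $\hat\Pi_i\text{-}(P)IND^-\le\hat\Sigma_i\text{-}(P)IND^-$ and $\hat\Pi_i\text{-}(P)IND^R\le\hat\Sigma_i\text{-}(P)IND^R$. 4. $\Gamma\text{-}PIND\le\Gamma\text{-}IND$, $\Gamma\text{-}PIND^-\le\Gamma\text{-}IND^-$ and $\Gamma\text{-}PIND^R\le\Gamma\text{-}IND^R$. 5. $\hat\Sigma_i\text{-}IND\le\hat\Sigma_{i+1}\text{-}PIND^R$. 6. $\hat\Sigma_i\text{-}IND^-\le\hat\Pi_{i+1}\text{-}PIND^-$ and $\hat\Sigma_i\text{-}IND^R\le\hat\Pi_{i+1}\text{-}PIND^R$. -/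

import Mathlib

open FirstOrder FirstOrder.Language

namespace TC0Arith

/-! ## The language: a function symbol for every function of uniform `TC⁰`

The symbols are the descriptions of functions in a function algebra for uniform `TC⁰`: the initial
functions `0`, `1`, `+`, `·`, `∸`, `⌊x/2⌋`, `|x|`, `x # y = 2^(|x||y|)`, `⌊x/2^y⌋` and the
projections, closed under composition, bit comprehension, sharply bounded minimization and
counting. The intended meaning of `compr f`, `minim f`, `count f` on `(x, y₁, …, yₙ)` is
* `compr f`: the number whose `i`-th bit is `1` iff `i < |x|` and `f(i, y₁, …, yₙ) ≠ 0`;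
* `minim f`: the least `i < |x|` with `f(i, y₁, …, yₙ) ≠ 0`, and `|x|` if there is none;
* `count f`: the number of `i < |x|` with `f(i, y₁, …, yₙ) ≠ 0`. -/

/-- Function symbols, indexed by their arity. -/
inductive Fn : ℕ → Type
  | zero : Fn 0
  | one : Fn 0
  | add : Fn 2
  | mul : Fn 2
  | sub : Fn 2
  | half : Fn 1
  | len : Fn 1
  | smash : Fn 2
  | msp : Fn 2
  | proj {n : ℕ} (j : Fin n) : Fn n
  | comp {m n : ℕ} (f : Fn m) (g : Fin m → Fn n) : Fn n
  | compr {n : ℕ} (f : Fn (n + 1)) : Fn (n + 1)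
  | minim {n : ℕ} (f : Fn (n + 1)) : Fn (n + 1)
  | count {n : ℕ} (f : Fn (n + 1)) : Fn (n + 1)

/-- The only relation symbol (besides equality) is `≤`. -/
inductive Rel : ℕ → Type
  | le : Rel 2

/-- The language `L_{TC⁰}`. -/
abbrev LTC : FirstOrder.Language.{0, 0} := ⟨Fn, Rel⟩

/-! ### Terms and atomic formulas -/

section Terms

variable {α : Type}

instance : Zero (LTC.Term α) := ⟨Term.func (L := LTC) Fn.zero ![]⟩
instance : One (LTC.Term α) := ⟨Term.func (L := LTC) Fn.one ![]⟩
instance : Add (LTC.Term α) := ⟨fun s t => Term.func (L := LTC) Fn.add ![s, t]⟩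
instance : Mul (LTC.Term α) := ⟨fun s t => Term.func (L := LTC) Fn.mul ![s, t]⟩

/-- Truncated subtraction `s ∸ t`. -/
instance : Sub (LTC.Term α) := ⟨fun s t => Term.func (L := LTC) Fn.sub ![s, t]⟩

/-- `⌊t/2⌋` -/
def half (t : LTC.Term α) : LTC.Term α := Term.func (L := LTC) Fn.half ![t]

/-- `|t|`, the length of the binary representation. -/
def len (t : LTC.Term α) : LTC.Term α := Term.func (L := LTC) Fn.len ![t]

/-- `s # t` -/
def smash (s t : LTC.Term α) : LTC.Term α := Term.func (L := LTC) Fn.smash ![s, t]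

/-- `⌊s/2^t⌋` -/
def msp (s t : LTC.Term α) : LTC.Term α := Term.func (L := LTC) Fn.msp ![s, t]

/-- `2t` -/
def dbl (t : LTC.Term α) : LTC.Term α := (1 + 1) * t

/-- The bit of `s` at position `t`, that is, `⌊s/2^t⌋ mod 2`. -/
def bit (s t : LTC.Term α) : LTC.Term α := msp s t - dbl (half (msp s t))

/-- `f(s, t₁, …, tₙ)` -/
def app {n : ℕ} (f : Fn (n + 1)) (s : LTC.Term α) (t : Fin n → LTC.Term α) : LTC.Term α :=
  Term.func (L := LTC) f (Fin.cons s t)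

/-- The formula `s = t`. -/
def eqF (s t : LTC.Term α) : LTC.Formula α := Term.equal s t

/-- The formula `s ≤ t`. -/
def leF (s t : LTC.Term α) : LTC.Formula α := Relations.formula₂ (L := LTC) Rel.le s t

/-- The formula `s < t`, an abbreviation of `¬ t ≤ s`. -/
def ltF (s t : LTC.Term α) : LTC.Formula α := ∼(leF t s)

end Terms

infix:63 " ≐ " => eqF
infix:63 " ≼ " => leF
infix:63 " ≺ " => ltF

/-- The universal closure of a formula with free variables among `x₀, …, x_{k-1}`. -/
def univ {k : ℕ} (φ : LTC.Formula (Fin k)) : LTC.Sentence :=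
  (BoundedFormula.relabel (Sum.inr : Fin k → Empty ⊕ Fin k) φ).alls

/-! ## The base theory `BTC⁰`: a universal theory -/

section Axioms

namespace Vars

/-! The variables of the basic axioms. -/

abbrev x : LTC.Term (Fin 4) := Term.var 0
abbrev y : LTC.Term (Fin 4) := Term.var 1
abbrev z : LTC.Term (Fin 4) := Term.var 2
abbrev w : LTC.Term (Fin 4) := Term.var 3

end Vars

open Vars in
/-- Quantifier-free axioms for the initial functions: Buss's `BASIC`, associativity of
multiplication, and the recursive definitions of `x ∸ y` and `⌊x/2^y⌋`. -/
inductive Basic : LTC.Formula (Fin 4) → Prop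
  | le_succ : Basic (y ≼ x ⟹ y ≼ x + 1)
  | ne_succ : Basic (∼(x ≐ x + 1))
  | zero_le : Basic (0 ≼ x)
  | lt_iff : Basic (((x ≼ y) ⊓ ∼(x ≐ y)) ⇔ (x + 1 ≼ y))
  | dbl_ne_zero : Basic (∼(x ≐ 0) ⟹ ∼(dbl x ≐ 0))
  | le_total : Basic ((y ≼ x) ⊔ (x ≼ y))
  | le_antisymm : Basic (((x ≼ y) ⊓ (y ≼ x)) ⟹ x ≐ y)
  | le_trans : Basic (((x ≼ y) ⊓ (y ≼ z)) ⟹ x ≼ z)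
  | len_zero : Basic (len 0 ≐ 0)
  | len_dbl : Basic (∼(x ≐ 0) ⟹ ((len (dbl x) ≐ len x + 1) ⊓ (len (dbl x + 1) ≐ len x + 1)))
  | len_one : Basic (len 1 ≐ 1)
  | len_mono : Basic (x ≼ y ⟹ len x ≼ len y)
  | len_smash : Basic (len (smash x y) ≐ len x * len y + 1)
  | zero_smash : Basic (smash 0 y ≐ 1)
  | one_smash : Basic (∼(x ≐ 0) ⟹
      ((smash 1 (dbl x) ≐ dbl (smash 1 x)) ⊓ (smash 1 (dbl x + 1) ≐ dbl (smash 1 x))))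
  | smash_comm : Basic (smash x y ≐ smash y x)
  | smash_congr : Basic (len x ≐ len y ⟹ smash x z ≐ smash y z)
  | smash_add : Basic (len x ≐ len y + len z ⟹ smash x w ≐ smash y w * smash z w)
  | le_add : Basic (x ≼ x + y)
  | dbl_lt : Basic (((x ≼ y) ⊓ ∼(x ≐ y)) ⟹ ((dbl x + 1 ≼ dbl y) ⊓ ∼(dbl x + 1 ≐ dbl y)))
  | add_comm : Basic (x + y ≐ y + x)
  | add_zero : Basic (x + 0 ≐ x)
  | add_succ : Basic (x + (y + 1) ≐ (x + y) + 1)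
  | add_assoc : Basic ((x + y) + z ≐ x + (y + z))
  | add_le_add : Basic ((x + y ≼ x + z) ⇔ (y ≼ z))
  | mul_zero : Basic (x * 0 ≐ 0)
  | mul_succ : Basic (x * (y + 1) ≐ x * y + x)
  | mul_comm : Basic (x * y ≐ y * x)
  | mul_add : Basic (x * (y + z) ≐ x * y + x * z)
  | mul_le_mul : Basic (1 ≼ x ⟹ ((x * y ≼ x * z) ⇔ (y ≼ z)))
  | len_half : Basic (∼(x ≐ 0) ⟹ len x ≐ len (half x) + 1)
  | half_iff : Basic ((x ≐ half y) ⇔ ((dbl x ≐ y) ⊔ (dbl x + 1 ≐ y)))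
  | mul_assoc : Basic ((x * y) * z ≐ x * (y * z))
  | sub_add : Basic (y ≼ x ⟹ (x - y) + y ≐ x)
  | sub_zero : Basic (x ≼ y ⟹ x - y ≐ 0)
  | msp_zero : Basic (msp x 0 ≐ x)
  | msp_succ : Basic (msp x (y + 1) ≐ half (msp x y))
  | msp_large : Basic (len x ≼ y ⟹ msp x y ≐ 0)

/-- The parameters `p₁, …, pₙ` of the defining axioms below, which have the further free
variables `i` and `b`. -/
def prm {n : ℕ} : Fin n → LTC.Term (Fin (n + 2)) := fun j => Term.var j.succ.succ

/-- The index variable `i` of the defining axioms. -/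
def idx {n : ℕ} : LTC.Term (Fin (n + 2)) := Term.var 0

/-- The variable `b` of the defining axioms, whose length bounds the indices. -/
def bd {n : ℕ} : LTC.Term (Fin (n + 2)) := Term.var 1

/-- The axioms of the theory `BTC⁰`: the basic axioms and the defining axioms of all function symbols. -/
inductive BTCAxiom : LTC.Sentence → Prop
  | basic {φ : LTC.Formula (Fin 4)} : Basic φ → BTCAxiom (univ φ)
  | proj {n : ℕ} (j : Fin n) :
      BTCAxiom (univ (Term.func (L := LTC) (Fn.proj j) Term.var ≐ Term.var j))
  | comp {m n : ℕ} (f : Fn m) (g : Fin m → Fn n) :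
      BTCAxiom (univ (Term.func (L := LTC) (Fn.comp f g) Term.var ≐
        Term.func (L := LTC) f fun j => Term.func (L := LTC) (g j) Term.var))
  | compr {n : ℕ} (f : Fn (n + 1)) :
      BTCAxiom (univ ((bit (app (Fn.compr f) bd prm) idx ≐ 1) ⇔
        ((idx ≺ len bd) ⊓ ∼(app f idx prm ≐ 0))))
  | minim_le {n : ℕ} (f : Fn (n + 1)) :
      BTCAxiom (univ (app (Fn.minim f) bd (prm (n := n)) ≼ len bd))
  | minim_least {n : ℕ} (f : Fn (n + 1)) :
      BTCAxiom (univ (idx ≺ app (Fn.minim f) bd prm ⟹ app f idx prm ≐ 0))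
  | minim_spec {n : ℕ} (f : Fn (n + 1)) :
      BTCAxiom (univ (app (Fn.minim f) bd prm ≺ len bd ⟹
        ∼(app f (app (Fn.minim f) bd prm) (prm (n := n)) ≐ 0)))
  | count_zero {n : ℕ} (f : Fn (n + 1)) :
      BTCAxiom (univ (app (Fn.count f) 0 (prm (n := n)) ≐ 0))
  | count_pos {n : ℕ} (f : Fn (n + 1)) :
      BTCAxiom (univ ((∼(bd ≐ 0) ⊓ ∼(app f (len (half bd)) (prm (n := n)) ≐ 0)) ⟹
        app (Fn.count f) bd prm ≐ app (Fn.count f) (half bd) prm + 1))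
  | count_neg {n : ℕ} (f : Fn (n + 1)) :
      BTCAxiom (univ ((∼(bd ≐ 0) ⊓ (app f (len (half bd)) (prm (n := n)) ≐ 0)) ⟹
        app (Fn.count f) bd prm ≐ app (Fn.count f) (half bd) prm))

/-- The theory `BTC⁰`. -/
def BTC : LTC.Theory := {φ | BTCAxiom φ}

end Axioms

/-! ## Strict bounded formulas -/

section Classes

variable {α : Type} {n : ℕ}

/-- `x ≤ t`, where `x` is the last bound variable, and `t` is a term without `x`. -/
def boundF (t : LTC.Term (α ⊕ Fin n)) : LTC.BoundedFormula α (n + 1) :=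
  Relations.boundedFormula₂ (L := LTC) Rel.le
    (Term.var (Sum.inr (Fin.last n))) (t.relabel (Sum.map id Fin.castSucc))

/-- The bounded quantifier `∃ x ≤ t, φ`. -/
def bEx (t : LTC.Term (α ⊕ Fin n)) (φ : LTC.BoundedFormula α (n + 1)) :
    LTC.BoundedFormula α n := ∃' (boundF t ⊓ φ)

/-- The bounded quantifier `∀ x ≤ t, φ`. -/
def bAll (t : LTC.Term (α ⊕ Fin n)) (φ : LTC.BoundedFormula α (n + 1)) :
    LTC.BoundedFormula α n := ∀' (boundF t ⟹ φ)

end Classes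

/-- Sharply bounded formulas: generated from atomic formulas by propositional connectives and
sharply bounded quantifiers `∃ x ≤ |t|`, `∀ x ≤ |t|`. -/
inductive IsSharp {α : Type} : ∀ {n : ℕ}, LTC.BoundedFormula α n → Prop
  | atomic {n : ℕ} {φ : LTC.BoundedFormula α n} : φ.IsAtomic → IsSharp φ
  | falsum {n : ℕ} : IsSharp (⊥ : LTC.BoundedFormula α n)
  | imp {n : ℕ} {φ ψ : LTC.BoundedFormula α n} : IsSharp φ → IsSharp ψ → IsSharp (φ ⟹ ψ)
  | ex {n : ℕ} {t : LTC.Term (α ⊕ Fin n)} {φ : LTC.BoundedFormula α (n + 1)} :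
      IsSharp φ → IsSharp (bEx (len t) φ)
  | all {n : ℕ} {t : LTC.Term (α ⊕ Fin n)} {φ : LTC.BoundedFormula α (n + 1)} :
      IsSharp φ → IsSharp (bAll (len t) φ)

/-- The type of the first quantifier block: existential or universal. -/
inductive Quant
  | sigma
  | pi

/-- The other type of quantifier. -/
def Quant.dual : Quant → Quant
  | .sigma => .pi
  | .pi => .sigma

/-- `IsStrict .sigma i φ`: `φ` is a strict `Σᵇᵢ` formula, i.e., it consists of `i` alternating,
possibly empty, blocks of bounded quantifiers, the first of them existential, followed by a sharply
bounded formula; `IsStrict .pi i φ`: the same for `Πᵇᵢ`, with the first block universal.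
The constructor `block` starts a new, so far empty, outermost block. -/
inductive IsStrict {α : Type} : Quant → ℕ → ∀ {n : ℕ}, LTC.BoundedFormula α n → Prop
  | sharp {q : Quant} {n : ℕ} {φ : LTC.BoundedFormula α n} : IsSharp φ → IsStrict q 0 φ
  | block {q : Quant} {i n : ℕ} {φ : LTC.BoundedFormula α n} :
      IsStrict q.dual i φ → IsStrict q (i + 1) φ
  | ex {i n : ℕ} {t : LTC.Term (α ⊕ Fin n)} {φ : LTC.BoundedFormula α (n + 1)} :
      IsStrict .sigma (i + 1) φ → IsStrict .sigma (i + 1) (bEx t φ)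
  | all {i n : ℕ} {t : LTC.Term (α ⊕ Fin n)} {φ : LTC.BoundedFormula α (n + 1)} :
      IsStrict .pi (i + 1) φ → IsStrict .pi (i + 1) (bAll t φ)

/-- Formulas `φ(x, y₁, …, yₖ)`; the variable `Sum.inl j` is the parameter `y_{j+1}`, and the
variable `Sum.inr 0` is the distinguished variable `x`. -/
abbrev IndFormula (k : ℕ) := LTC.Formula (Fin k ⊕ Fin 1)

/-- Classes of formulas `φ(x, y₁, …, yₖ)` for all numbers `k` of parameters. -/
abbrev FormulaClass := ∀ k : ℕ, Set (IndFormula k)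

/-- The class of strict `Σᵇᵢ` formulas. -/
def SigmaHat (i : ℕ) : FormulaClass := fun _ => {φ | IsStrict .sigma i φ}

/-- The class of strict `Πᵇᵢ` formulas. -/
def PiHat (i : ℕ) : FormulaClass := fun _ => {φ | IsStrict .pi i φ}

/-! ## Rules and reducibility -/

/-- A rule is a set of instances `Γ / φ`, where `Γ` is a finite set of sentences and `φ` is a
sentence. Axiom schemes are the rules all of whose instances have no premises. -/
abbrev Rule := Set (Finset LTC.Sentence × LTC.Sentence)

/-- `[T, R]`: the closure of `T` under unnested applications of instances of `R`. -/
def unnested (T : LTC.Theory) (R : Rule) : Set LTC.Sentence :=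
  {φ | (T ∪ {ψ | ∃ Γ, (Γ, ψ) ∈ R ∧ ∀ γ ∈ Γ, T ⊨ᵇ γ}) ⊨ᵇ φ}

/-- `R ≤ S`: `[T, R] ⊆ [T, S]` for all extensions `T` of `BTC⁰`. -/
def Reducible (R S : Rule) : Prop :=
  ∀ T : LTC.Theory, BTC ⊆ T → unnested T R ⊆ unnested T S

/-- `R ≡ S` -/
def Equivalent (R S : Rule) : Prop := Reducible R S ∧ Reducible S R

infix:50 " ≤ᵣ " => Reducible
infix:50 " ≡ᵣ " => Equivalent

/-! ## Induction axioms and rules -/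

/-- Induction and polynomial induction. -/
inductive IndKind
  | ind
  | pind

section Induction

variable {k : ℕ}

/-- The formula `φ(t, y₁, …, yₖ)`. -/
def atTerm {β : Type} (φ : IndFormula k) (p : Fin k → β) (t : LTC.Term β) : LTC.Formula β :=
  BoundedFormula.subst φ (Sum.elim (fun j => Term.var (p j)) fun _ => t)

/-- The formula `∀ x, φ(x, y₁, …, yₖ)`. -/
def allX (φ : IndFormula k) : LTC.Formula (Fin k) :=
  (BoundedFormula.relabel (id : Fin k ⊕ Fin 1 → Fin k ⊕ Fin 1) φ).all

/-- The distinguished variable `x`. -/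
def indVar : LTC.Term (Fin k ⊕ Fin 1) := Term.var (Sum.inr 0)

/-- The formula `φ(0, y₁, …, yₖ)`. -/
def baseF (φ : IndFormula k) : LTC.Formula (Fin k) := atTerm φ id 0

/-- The induction step: `φ(x, y) → φ(x + 1, y)` for induction, and `φ(⌊x/2⌋, y) → φ(x, y)` for
polynomial induction. -/
def stepF : IndKind → IndFormula k → IndFormula k
  | .ind, φ => φ ⟹ atTerm φ Sum.inl (indVar + 1)
  | .pind, φ => atTerm φ Sum.inl (half indVar) ⟹ φ

/-- The (universal closure of the) axiom `φ`-IND or `φ`-PIND. -/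
def indAxiom (s : IndKind) (φ : IndFormula k) : LTC.Sentence :=
  univ ((baseF φ ⊓ allX (stepF s φ)) ⟹ allX φ)

open Classical in
/-- The instance of the induction rule for `φ`: from (the universal closures of) `φ(0, y)` and the
induction step, infer (the universal closure of) `φ(x, y)`. -/
noncomputable def indInstance (s : IndKind) (φ : IndFormula k) :
    Finset LTC.Sentence × LTC.Sentence :=
  ({univ (baseF φ), univ (allX (stepF s φ))}, univ (allX φ))

end Induction

/-- The scheme `Γ`-IND or `Γ`-PIND, with parameters. -/
def Scheme (s : IndKind) (Γ : FormulaClass) : Rule :=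
  {r | ∃ (k : ℕ) (φ : IndFormula k), φ ∈ Γ k ∧ r = (∅, indAxiom s φ)}

/-- The parameter-free scheme `Γ`-IND⁻ or `Γ`-PIND⁻. -/
def SchemePF (s : IndKind) (Γ : FormulaClass) : Rule :=
  {r | ∃ φ : IndFormula 0, φ ∈ Γ 0 ∧ r = (∅, indAxiom s φ)}

/-- The rule `Γ`-IND^R or `Γ`-PIND^R, with parameters. -/
def IndRule (s : IndKind) (Γ : FormulaClass) : Rule :=
  {r | ∃ (k : ℕ) (φ : IndFormula k), φ ∈ Γ k ∧ r = indInstance s φ}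

end TC0Arith

open TC0Arith

namespace TC0Arith

/-! All reductions are checked in one model of `BTC` at a time, the premises of rules being
quantified over all models of `T`. A model is the nonnegative part of a discretely ordered ring. In
it, sharply bounded formulas define exactly the predicates `F ≠ 0` with `F` a function symbol,
because minimization absorbs sharply bounded quantifiers. Strict formulas thus become the predicate
classes `SD q i`, which are closed under `∧`, `∨`, substitution of function symbols, and negation up
to duality (`IsStrict.sd`, `SD.exists_strict`).

Parameters are eliminated (`PFHolds.of_prem`) by a coding `z ↦ (low z, rest z)` that is onto and
respects the induction order: passing from `z` to `z + 1` either resets `low` to 0, or increments it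
and keeps `rest`, and similarly for halving (`low_succ`, `low_hf`, `exists_low_rest`). If the
premises for `P` hold for all parameters, they hold for `P (low z, low (rest z), …)`, which has no
parameters. So a parameter-free scheme proves every rule with parameters, and one translation of
premises (`Translates`) handles rules and parameter-free schemes together.

The other reductions each choose an auxiliary predicate of `x`. Duality runs induction backwards on
`¬ P(a ∸ x)` or `¬ P(⌊a/2^|x|⌋)`; the rule version adds a disjunct `θ`, where `P = ∀ w θ`. PIND
follows from IND along the prefixes `⌊a/2^(|a| ∸ x)⌋` of `a`. Σ-IND follows from the PIND rule one
level up by binary search for a place where the induction step fails (`prem_searchPred`). The rule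
and parameter-free versions use `∀ u ≤ a, P(u) → P(min(u + x, a))`, whose step from `⌊x/2⌋` to `x`
composes a shift with itself (`translates_ind_pind`). -/

/-- Models of `BTC⁰`. -/
abbrev Model := Theory.ModelType.{0, 0, 0} BTC

/-! ### Truth of closures and substitutions in a structure -/

section Semantics

variable {M : Type} [LTC.Structure M] {k : ℕ}

theorem realize_univ {φ : LTC.Formula (Fin k)} : M ⊨ univ φ ↔ ∀ v : Fin k → M, φ.Realize v := by
  unfold univ Sentence.Realize
  rw [BoundedFormula.realize_alls]
  unfold Formula.Realize
  constructor
  · intro h v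
    have := h (v ∘ Fin.cast (Nat.add_zero k))
    rw [BoundedFormula.realize_relabel] at this
    convert this using 1
    rfl
  · intro h v
    rw [BoundedFormula.realize_relabel]
    convert h (v ∘ Fin.castAdd 0) using 1
    rfl

theorem realize_atTerm {β : Type} {φ : IndFormula k} {p : Fin k → β} {t : LTC.Term β} {v : β → M} :
    (atTerm φ p t).Realize v ↔ φ.Realize (Sum.elim (v ∘ p) fun _ => t.realize v) := by
  unfold atTerm Formula.Realize
  rw [BoundedFormula.realize_subst]
  apply iff_of_eq
  congr 1
  ext (a | a) <;> rfl

theorem realize_allX {φ : IndFormula k} {v : Fin k → M} :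
    (allX φ).Realize v ↔ ∀ x : M, φ.Realize (Sum.elim v fun _ => x) := by
  unfold allX Formula.Realize
  rw [BoundedFormula.realize_all]
  refine forall_congr' fun x => ?_
  rw [BoundedFormula.realize_relabel]
  convert Iff.rfl using 2
  ext (a | a)
  · rfl
  · obtain rfl : a = 0 := Subsingleton.elim _ _
    simp [Fin.snoc]

end Semantics

/-! ### The operations of a model -/

section Operations

variable (M : Model)

instance : Zero M := ⟨Structure.funMap (L := LTC) Fn.zero ![]⟩
instance : One M := ⟨Structure.funMap (L := LTC) Fn.one ![]⟩
instance : Add M := ⟨fun a b => Structure.funMap (L := LTC) Fn.add ![a, b]⟩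
instance : Mul M := ⟨fun a b => Structure.funMap (L := LTC) Fn.mul ![a, b]⟩
instance : Sub M := ⟨fun a b => Structure.funMap (L := LTC) Fn.sub ![a, b]⟩
instance : LE M := ⟨fun a b => Structure.RelMap (L := LTC) Rel.le ![a, b]⟩

variable {M}

/-- `⌊a/2⌋` -/
def hf (a : M) : M := Structure.funMap (L := LTC) Fn.half ![a]

/-- `|a|` -/
def ln (a : M) : M := Structure.funMap (L := LTC) Fn.len ![a]

/-- `a # b` -/
def sm (a b : M) : M := Structure.funMap (L := LTC) Fn.smash ![a, b]

/-- `⌊a/2^b⌋` -/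
def ms (a b : M) : M := Structure.funMap (L := LTC) Fn.msp ![a, b]

/-- The value of the function with symbol `f`. -/
def ev {n : ℕ} (f : Fn n) (v : Fin n → M) : M := Structure.funMap (L := LTC) f v

variable {α : Type} {v : α → M} {s t : LTC.Term α}

theorem realize_func {n : ℕ} (f : Fn n) (ts : Fin n → LTC.Term α) :
    (Term.func (L := LTC) f ts).realize v = ev f fun i => (ts i).realize v := rfl

theorem realize_app {n : ℕ} (f : Fn (n + 1)) (ts : Fin n → LTC.Term α) :
    (app f s ts).realize v = ev f (Fin.cons (s.realize v) fun i => (ts i).realize v) := by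
  unfold app
  rw [realize_func]
  congr 1
  ext i
  refine Fin.cases ?_ (fun i => ?_) i <;> simp

theorem map_pair {n : LTC.Term α → M} :
    (fun i => n ((![s, t] : Fin 2 → LTC.Term α) i)) = ![n s, n t] := by
  ext i; fin_cases i <;> rfl

theorem map_single {n : LTC.Term α → M} :
    (fun i => n ((![s] : Fin 1 → LTC.Term α) i)) = ![n s] := by
  ext i; fin_cases i; rfl

@[simp] theorem realize_zero : (0 : LTC.Term α).realize v = 0 :=
  congrArg (Structure.funMap (L := LTC) Fn.zero) (Subsingleton.elim _ _)
@[simp] theorem realize_one : (1 : LTC.Term α).realize v = 1 :=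
  congrArg (Structure.funMap (L := LTC) Fn.one) (Subsingleton.elim _ _)
@[simp] theorem realize_add : (s + t).realize v = s.realize v + t.realize v :=
  congrArg (Structure.funMap (L := LTC) Fn.add) map_pair
@[simp] theorem realize_mul : (s * t).realize v = s.realize v * t.realize v :=
  congrArg (Structure.funMap (L := LTC) Fn.mul) map_pair
@[simp] theorem realize_sub : (s - t).realize v = s.realize v - t.realize v :=
  congrArg (Structure.funMap (L := LTC) Fn.sub) map_pair
@[simp] theorem realize_half : (half s).realize v = hf (s.realize v) :=
  congrArg (Structure.funMap (L := LTC) Fn.half) map_single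
@[simp] theorem realize_len : (len s).realize v = ln (s.realize v) :=
  congrArg (Structure.funMap (L := LTC) Fn.len) map_single
@[simp] theorem realize_smash : (smash s t).realize v = sm (s.realize v) (t.realize v) :=
  congrArg (Structure.funMap (L := LTC) Fn.smash) map_pair
@[simp] theorem realize_msp : (msp s t).realize v = ms (s.realize v) (t.realize v) :=
  congrArg (Structure.funMap (L := LTC) Fn.msp) map_pair
@[simp] theorem realize_dbl : (dbl s).realize v = (1 + 1) * s.realize v := by
  simp [dbl]
@[simp] theorem realize_eqF : (s ≐ t).Realize v ↔ s.realize v = t.realize v :=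
  Formula.realize_equal
@[simp] theorem realize_leF : (s ≼ t).Realize v ↔ s.realize v ≤ t.realize v :=
  Formula.realize_rel₂
@[simp] theorem realize_ltF : (s ≺ t).Realize v ↔ ¬ t.realize v ≤ s.realize v := by
  simp [ltF, Formula.realize_not]

theorem realize_axiom (M : Model) {φ : LTC.Sentence} (h : BTCAxiom φ) : M ⊨ φ :=
  Theory.realize_sentence_of_mem BTC h

theorem realize_basic (M : Model) {φ : LTC.Formula (Fin 4)} (h : Basic φ) (v : Fin 4 → M) :
    φ.Realize v :=
  realize_univ.1 (realize_axiom M (.basic h)) v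

@[simp] theorem realize_iff' {φ ψ : LTC.Formula α} :
    Formula.Realize (φ ⇔ ψ) v ↔ (φ.Realize v ↔ ψ.Realize v) := BoundedFormula.realize_iff
@[simp] theorem realize_imp' {φ ψ : LTC.Formula α} :
    Formula.Realize (φ ⟹ ψ) v ↔ (φ.Realize v → ψ.Realize v) := BoundedFormula.realize_imp
@[simp] theorem realize_inf' {φ ψ : LTC.Formula α} :
    Formula.Realize (φ ⊓ ψ) v ↔ (φ.Realize v ∧ ψ.Realize v) := BoundedFormula.realize_inf
@[simp] theorem realize_sup' {φ ψ : LTC.Formula α} :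
    Formula.Realize (φ ⊔ ψ) v ↔ (φ.Realize v ∨ ψ.Realize v) := BoundedFormula.realize_sup

end Operations

/-! ### A model is the nonnegative part of a discretely ordered ring -/

section Order

open Vars

variable {M : Model}

theorem zero_le_model (a : M) : 0 ≤ a := by
  simpa using realize_basic M .zero_le ![a, 0, 0, 0]

theorem le_total_model (a b : M) : a ≤ b ∨ b ≤ a := by
  simpa using realize_basic M .le_total ![b, a, 0, 0]

noncomputable instance : LinearOrder M where
  le_refl a := by simpa using le_total_model a a
  le_trans a b c h h' := by
    simpa [h, h'] using realize_basic M .le_trans ![a, b, c, 0]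
  le_antisymm a b h h' := by
    simpa [h, h'] using realize_basic M .le_antisymm ![a, b, 0, 0]
  le_total := le_total_model
  toDecidableLE := Classical.decRel _

theorem add_comm_model (a b : M) : a + b = b + a := by
  simpa using realize_basic M .add_comm ![a, b, 0, 0]

theorem add_zero_model (a : M) : a + 0 = a := by
  simpa using realize_basic M .add_zero ![a, 0, 0, 0]

theorem mul_comm_model (a b : M) : a * b = b * a := by
  simpa using realize_basic M .mul_comm ![a, b, 0, 0]

theorem mul_zero_model (a : M) : a * 0 = 0 := by
  simpa using realize_basic M .mul_zero ![a, 0, 0, 0]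

theorem mul_add_model (a b c : M) : a * (b + c) = a * b + a * c := by
  simpa using realize_basic M .mul_add ![a, b, c, 0]

theorem mul_one_model (a : M) : a * 1 = a := by
  have := realize_basic M .mul_succ ![a, 0, 0, 0]
  simp [mul_zero_model] at this
  rwa [add_comm_model 0, add_comm_model 0, add_zero_model, add_zero_model] at this

theorem mul_assoc_model (a b c : M) : (a * b) * c = a * (b * c) := by
  simpa using realize_basic M .mul_assoc ![a, b, c, 0]

noncomputable instance : CommSemiring M where
  nsmul := nsmulRec
  npow := npowRec
  add_assoc a b c := by simpa using realize_basic M .add_assoc ![a, b, c, 0]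
  zero_add a := by rw [add_comm_model, add_zero_model]
  add_zero := add_zero_model
  add_comm := add_comm_model
  left_distrib := mul_add_model
  right_distrib a b c := by
    rw [mul_comm_model, mul_add_model, mul_comm_model c, mul_comm_model c]
  zero_mul a := by rw [mul_comm_model, mul_zero_model]
  mul_zero := mul_zero_model
  mul_assoc := mul_assoc_model
  one_mul a := by rw [mul_comm_model, mul_one_model]
  mul_one := mul_one_model
  mul_comm := mul_comm_model

theorem succ_le_iff {a b : M} : a + 1 ≤ b ↔ a < b := by
  have := realize_basic M .lt_iff ![a, b, 0, 0]
  simp at this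
  rw [← this, lt_iff_le_and_ne]

theorem sub_add_model {a b : M} (h : b ≤ a) : (a - b) + b = a := by
  simpa [h] using realize_basic M .sub_add ![a, b, 0, 0]

theorem sub_of_le {a b : M} (h : a ≤ b) : a - b = 0 := by
  simpa [h] using realize_basic M .sub_zero ![a, b, 0, 0]

theorem add_le_add_iff_model {a b c : M} : a + b ≤ a + c ↔ b ≤ c := by
  simpa using realize_basic M .add_le_add ![a, b, c, 0]

theorem le_self_add_model (a b : M) : a ≤ a + b := by
  simpa using realize_basic M .le_add ![a, b, 0, 0]

theorem mul_le_mul_iff_model {a b c : M} (h : 1 ≤ a) : a * b ≤ a * c ↔ b ≤ c := by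
  simpa [h] using realize_basic M .mul_le_mul ![a, b, c, 0]

theorem one_le_iff {a : M} : 1 ≤ a ↔ 0 < a := by
  rw [← succ_le_iff, zero_add]

instance : IsOrderedCancelAddMonoid M where
  add_le_add_left a b h c := by
    rw [add_comm a, add_comm b]; exact add_le_add_iff_model.2 h
  le_of_add_le_add_left a b c h := add_le_add_iff_model.1 h

instance : Nontrivial M := ⟨0, 0 + 1, by
  simpa using realize_basic M .ne_succ ![0, 0, 0, 0]⟩

instance : CanonicallyOrderedAdd M where
  exists_add_of_le {a b} h := ⟨b - a, by rw [add_comm, sub_add_model h]⟩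
  le_self_add := le_self_add_model
  le_add_self a b := by rw [add_comm]; exact le_self_add_model a b

theorem mul_lt_mul_model {a b c : M} (h : 0 < a) (hb : b < c) : a * b < a * c :=
  not_le.1 fun h' => hb.not_ge ((mul_le_mul_iff_model (one_le_iff.2 h)).1 h')

instance : IsStrictOrderedRing M where
  zero_le_one := zero_le_model 1
  le_of_add_le_add_left a b c h := add_le_add_iff_model.1 h
  mul_lt_mul_of_pos_left a h b c hb := mul_lt_mul_model h hb
  mul_lt_mul_of_pos_right a h b c hb := by
    simpa only [mul_comm] using mul_lt_mul_model h hb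

instance : OrderedSub M where
  tsub_le_iff_right a b c := by
    rcases le_total b a with h | h
    · conv_rhs => rw [← sub_add_model h]
      exact (add_le_add_iff_right b).symm
    · rw [sub_of_le h]
      simp [h.trans (le_add_left le_rfl)]

end Order

/-! ### Functions and predicates defined uniformly in all models -/

section Functions

/-- Uniform families of functions on models. -/
abbrev Fam (n : ℕ) := ∀ M : Model, (Fin n → M) → M

/-- The family `F` is given by a function symbol. -/
def Rep {n : ℕ} (F : Fam n) : Prop := ∃ f : Fn n, ∀ M v, F M v = ev f v

variable {n m : ℕ} {F G : Fam n}

theorem ev_proj {M : Model} (j : Fin n) (v : Fin n → M) : ev (Fn.proj j) v = v j := by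
  have := realize_univ.1 (realize_axiom M (.proj j)) v
  rwa [realize_eqF] at this

theorem ev_comp {M : Model} (f : Fn m) (g : Fin m → Fn n) (v : Fin n → M) :
    ev (Fn.comp f g) v = ev f fun j => ev (g j) v := by
  have := realize_univ.1 (realize_axiom M (.comp f g)) v
  rwa [realize_eqF] at this

theorem Rep.ev (f : Fn n) : Rep fun _ v => ev f v := ⟨f, fun _ _ => rfl⟩

theorem Rep.var (j : Fin n) : Rep fun _ v => v j := ⟨.proj j, fun _ v => (ev_proj j v).symm⟩

theorem Rep.subst {F : Fam m} (hF : Rep F) {H : Fin m → Fam n} (hH : ∀ j, Rep (H j)) :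
    Rep fun M v => F M fun j => H j M v := by
  obtain ⟨f, hf⟩ := hF
  choose h hh using hH
  exact ⟨.comp f h, fun M v => by simp only [ev_comp, hf, hh]⟩

theorem Rep.comp₁ {F : Fam 1} (hF : Rep F) (hG : Rep G) : Rep fun M v => F M ![G M v] := by
  convert hF.subst (H := ![G]) (Fin.forall_fin_one.2 hG) using 4 with M v
  ext j; fin_cases j; rfl

theorem Rep.comp₂ {F : Fam 2} (hF : Rep F) {G₁ G₂ : Fam n} (h₁ : Rep G₁) (h₂ : Rep G₂) :
    Rep fun M v => F M ![G₁ M v, G₂ M v] := by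
  convert hF.subst (H := ![G₁, G₂]) (Fin.forall_fin_two.2 ⟨h₁, h₂⟩) using 4 with M v
  ext j; fin_cases j <;> rfl

theorem Rep.zero : Rep (n := n) fun _ _ => 0 :=
  ⟨.comp .zero ![], fun M v => by
    rw [ev_comp]; exact congrArg (Structure.funMap (L := LTC) Fn.zero) (Subsingleton.elim _ _)⟩

theorem Rep.one : Rep (n := n) fun _ _ => 1 :=
  ⟨.comp .one ![], fun M v => by
    rw [ev_comp]; exact congrArg (Structure.funMap (L := LTC) Fn.one) (Subsingleton.elim _ _)⟩

theorem Rep.add (hF : Rep F) (hG : Rep G) : Rep fun M v => F M v + G M v :=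
  (Rep.ev .add).comp₂ hF hG

theorem Rep.mul (hF : Rep F) (hG : Rep G) : Rep fun M v => F M v * G M v :=
  (Rep.ev .mul).comp₂ hF hG

theorem Rep.sub (hF : Rep F) (hG : Rep G) : Rep fun M v => F M v - G M v :=
  (Rep.ev .sub).comp₂ hF hG

theorem Rep.hf (hF : Rep F) : Rep fun M v => hf (F M v) := (Rep.ev .half).comp₁ hF

theorem Rep.ln (hF : Rep F) : Rep fun M v => ln (F M v) := (Rep.ev .len).comp₁ hF

theorem Rep.sm (hF : Rep F) (hG : Rep G) : Rep fun M v => sm (F M v) (G M v) :=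
  (Rep.ev .smash).comp₂ hF hG

theorem Rep.ms (hF : Rep F) (hG : Rep G) : Rep fun M v => ms (F M v) (G M v) :=
  (Rep.ev .msp).comp₂ hF hG

theorem Rep.cons {F : Fam (m + 1)} (hF : Rep F) {G : Fam n} (hG : Rep G) {H : Fin m → Fam n}
    (hH : ∀ j, Rep (H j)) :
    Rep fun M v => F M (Fin.cons (G M v) fun j => H j M v) := by
  convert hF.subst (H := Fin.cons G H) (Fin.cases hG hH) using 4 with M v
  ext j
  refine Fin.cases ?_ (fun j => ?_) j <;> rfl

theorem Rep.term {β : Type} (t : LTC.Term β) (e : β → Fin n) :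
    Rep fun _ w => t.realize (w ∘ e) := by
  induction t with
  | var b => exact Rep.var (e b)
  | func f ts ih => exact (Rep.ev f).subst ih

end Functions

/-! ### Minimization as a sharply bounded existential quantifier -/

section Minimization

variable {M : Model} {n : ℕ} (f : Fn (n + 1))

theorem minim_le (b : M) (v : Fin n → M) : ev (Fn.minim f) (Fin.cons b v) ≤ ln b := by
  simpa [realize_app, prm, bd] using
    realize_univ.1 (realize_axiom M (.minim_le f)) (Fin.cons 0 (Fin.cons b v))

theorem minim_least {b i : M} {v : Fin n → M} (h : i < ev (Fn.minim f) (Fin.cons b v)) :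
    ev f (Fin.cons i v) = 0 := by
  have := realize_univ.1 (realize_axiom M (.minim_least f)) (Fin.cons i (Fin.cons b v))
  simpa [realize_app, prm, bd, idx, h] using this

theorem minim_spec {b : M} {v : Fin n → M} (h : ev (Fn.minim f) (Fin.cons b v) < ln b) :
    ev f (Fin.cons (ev (Fn.minim f) (Fin.cons b v)) v) ≠ 0 := by
  have := realize_univ.1 (realize_axiom M (.minim_spec f)) (Fin.cons 0 (Fin.cons b v))
  simpa [realize_app, prm, bd, idx, h] using this

/-- The value `|b|` signals that the search failed. This turns a sharply bounded quantifier into a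
comparison of two function values. -/
theorem exists_lt_ln_iff {b : M} {v : Fin n → M} :
    (∃ i < ln b, ev f (Fin.cons i v) ≠ 0) ↔ ev (Fn.minim f) (Fin.cons b v) < ln b :=
  ⟨fun ⟨_, hi, h⟩ => (not_lt.1 fun h' => h (minim_least f h')).trans_lt hi,
    fun h => ⟨_, h, minim_spec f h⟩⟩

theorem ln_one : ln (1 : M) = 1 := by
  simpa using realize_basic M .len_one 0

theorem ln_zero : ln (0 : M) = 0 := by
  simpa using realize_basic M .len_zero 0

/-- Minimization searches `i < |b|`, whereas quantifiers range over `i ≤ |a|`; taking `b = 2a + 1`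
reconciles them. -/
theorem ln_bit1 (a : M) : ln (2 * a + 1) = ln a + 1 := by
  by_cases h : a = 0
  · simp [h, ln_zero, ln_one]
  · have := realize_basic M .len_dbl ![a, 0, 0, 0]
    simp [h, Vars.x, one_add_one_eq_two] at this
    exact this.2

theorem lt_add_one_iff_model {a b : M} : a < b + 1 ↔ a ≤ b := by
  rw [← succ_le_iff, add_le_add_iff_right]

end Minimization

/-! ### The semantic counterpart of strict formulas -/

section Predicates

/-- Uniform families of predicates on models. -/
abbrev Pred (n : ℕ) := ∀ M : Model, (Fin n → M) → Prop

/-- A bounded quantifier applied to a family of predicates. -/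
def bq {n : ℕ} : Quant → Fn n → Pred (n + 1) → Pred n
  | .sigma, g, P => fun M v => ∃ x ≤ ev g v, P M (Fin.cons x v)
  | .pi, g, P => fun M v => ∀ x ≤ ev g v, P M (Fin.cons x v)

/-- Closure of a class of predicates under bounded quantifiers of one type. -/
inductive Blk (q : Quant) (C : ∀ n, Pred n → Prop) : ∀ n, Pred n → Prop
  | base {n : ℕ} {P : Pred n} : C n P → Blk q C n P
  | quant {n : ℕ} {P : Pred (n + 1)} (g : Fn n) : Blk q C (n + 1) P → Blk q C n (bq q g P)

/-- Predicates definable by strict formulas. -/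
def SD : Quant → ℕ → ∀ n, Pred n → Prop
  | _, 0 => fun _ P => ∃ F, Rep F ∧ ∀ M v, P M v ↔ F M v ≠ 0
  | q, i + 1 => Blk q (SD q.dual i)

variable {n m i : ℕ} {q : Quant}

theorem SD.congr {P Q : Pred n} (hP : SD q i n P) (h : ∀ M v, P M v ↔ Q M v) : SD q i n Q := by
  rwa [show P = Q from funext fun M => funext fun v => propext (h M v)] at hP

theorem SD.subst {P : Pred n} (hP : SD q i n P) {H : Fin n → Fam m} (hH : ∀ j, Rep (H j)) :
    SD q i m fun M v => P M fun j => H j M v := by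
  induction i generalizing q n m with
  | zero =>
    obtain ⟨F, hF, h⟩ := hP
    exact ⟨_, hF.subst hH, fun M v => h M _⟩
  | succ i ih =>
    simp only [SD] at hP ⊢
    induction hP generalizing m with
    | base h => exact .base (ih h hH)
    | @quant n P g h ihP =>
      obtain ⟨g', hg'⟩ := (Rep.ev g).subst hH
      have := ihP (H := Fin.cons (fun _ v => v 0) fun j M v => H j M fun l => v l.succ)
        (Fin.cases (Rep.var _) fun j => (hH j).subst fun l => Rep.var l.succ)
      convert Blk.quant g' this using 3 with M v
      cases q <;> simp only [bq, hg'] <;> [apply iff_of_eq; apply iff_of_eq] <;> congr! 5 <;>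
        · rename_i j
          refine Fin.cases ?_ (fun j => ?_) j <;> rfl

theorem SD.block {P : Pred n} (hP : SD q.dual i n P) : SD q (i + 1) n P := Blk.base hP

/-- The additional empty block is inserted innermost, so the type of the outermost block is kept;
`SD.block` adds it outermost and changes the type. -/
theorem SD.succ {P : Pred n} (hP : SD q i n P) : SD q (i + 1) n P := by
  induction i generalizing q n with
  | zero => exact Blk.base hP
  | succ i ih =>
    simp only [SD] at hP ⊢
    induction hP with
    | base h => exact .base (ih h)
    | quant g _ ihP => exact .quant g ihP

theorem SD.lift {q' : Quant} {P : Pred n} (hP : SD q i n P) : SD q' (i + 1) n P := by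
  cases q <;> cases q' <;>
    first | exact hP.succ | exact SD.block (q := .sigma) hP | exact SD.block (q := .pi) hP

theorem SD.not {P : Pred n} (hP : SD q i n P) : SD q.dual i n fun M v => ¬ P M v := by
  induction i generalizing q n with
  | zero =>
    obtain ⟨F, hF, h⟩ := hP
    refine ⟨_, Rep.one.sub hF, fun M v => ?_⟩
    show ¬ P M v ↔ _
    rw [h, ne_eq, not_not, ne_eq, tsub_eq_zero_iff_le, one_le_iff, not_lt, nonpos_iff_eq_zero]
  | succ i ih =>
    simp only [SD] at hP ⊢
    induction hP with
    | base h => exact .base (ih h)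
    | quant g _ ihP =>
      convert Blk.quant g ihP using 3 with M v
      cases q <;> simp [bq, Quant.dual]

theorem Quant.dual_dual (q : Quant) : q.dual.dual = q := by cases q <;> rfl

theorem SD.not' {P : Pred n} (hP : SD q.dual i n P) : SD q i n fun M v => ¬ P M v := by
  have := hP.not
  rwa [Quant.dual_dual] at this

theorem SD.weaken {P : Pred n} (hP : SD q i n P) : SD q i (n + 1) fun M v => P M fun j => v j.succ :=
  hP.subst fun j => Rep.var j.succ

/-- Prenexing is sound for bounded quantifiers because the range is never empty: it contains 0. -/
theorem bq_or {g : Fn n} {P : Pred (n + 1)} {Q : Pred n} :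
    (bq q g fun M v => P M v ∨ Q M fun j => v j.succ) = fun M v => bq q g P M v ∨ Q M v := by
  ext M v
  cases q
  · simp only [bq, Fin.cons_succ]
    refine ⟨?_, ?_⟩
    · rintro ⟨x, hx, h | h⟩
      exacts [.inl ⟨x, hx, h⟩, .inr h]
    · rintro (⟨x, hx, h⟩ | h)
      exacts [⟨x, hx, .inl h⟩, ⟨0, zero_le_model _, .inr h⟩]
  · simp only [bq, Fin.cons_succ]
    refine ⟨fun h => ?_, ?_⟩
    · by_cases hQ : Q M v
      exacts [.inr hQ, .inl fun x hx => (h x hx).resolve_right hQ]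
    · rintro (h | h) x hx
      exacts [.inl (h x hx), .inr h]

/-- The outer blocks have the same type, so the quantifiers of `P` and then those of `Q` can be
pulled out into one block, leaving a disjunction one level lower. At level 0, a sum is nonzero iff
one summand is. -/
theorem SD.or {P Q : Pred n} (hP : SD q i n P) (hQ : SD q i n Q) :
    SD q i n fun M v => P M v ∨ Q M v := by
  induction i generalizing q n with
  | zero =>
    obtain ⟨F, hF, h⟩ := hP
    obtain ⟨G, hG, h'⟩ := hQ
    refine ⟨_, hF.add hG, fun M v => ?_⟩
    show P M v ∨ Q M v ↔ _
    rw [h, h', ne_eq, ne_eq, ne_eq, add_eq_zero, not_and_or]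
  | succ i ih =>
    simp only [SD] at hP
    induction hP with
    | @base n P h =>
      simp only [SD] at hQ
      induction hQ with
      | base h' => exact Blk.base (ih h h')
      | quant g _ ihQ =>
        have := Blk.quant g (ihQ (SD.weaken h))
        simp only [or_comm (a := P _ _)]
        simp only [or_comm (a := P _ _)] at this
        rw [bq_or] at this
        exact this
    | quant g _ ihP =>
      have := Blk.quant g (ihP hQ.weaken)
      rw [bq_or] at this
      exact this

theorem SD.and {P Q : Pred n} (hP : SD q i n P) (hQ : SD q i n Q) :
    SD q i n fun M v => P M v ∧ Q M v :=
  (hP.not.or hQ.not).not'.congr fun M v => by tauto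

theorem SD.of_zero {q' : Quant} {P : Pred n} (hP : SD q' 0 n P) : SD q i n P := by
  induction i generalizing q with
  | zero => exact hP
  | succ i ih => exact (ih (q := q)).succ

theorem SD.le {F G : Fam n} (hF : Rep F) (hG : Rep G) : SD q i n fun M v => F M v ≤ G M v :=
  SD.of_zero (q' := .sigma) <| SD.congr (SD.not' (i := 0) ⟨_, hF.sub hG, fun _ _ => Iff.rfl⟩)
    fun M v => by rw [ne_eq, not_not, tsub_eq_zero_iff_le]

theorem SD.eq {F G : Fam n} (hF : Rep F) (hG : Rep G) : SD q i n fun M v => F M v = G M v :=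
  ((SD.le hF hG).and (SD.le hG hF)).congr fun _ _ => le_antisymm_iff.symm

theorem SD.bex {P : Pred (n + 1)} {F : Fam n} (hF : Rep F) (hP : SD .sigma (i + 1) (n + 1) P) :
    SD .sigma (i + 1) n fun M v => ∃ x ≤ F M v, P M (Fin.cons x v) := by
  obtain ⟨g, hg⟩ := hF
  exact SD.congr (i := i + 1) (Blk.quant g hP) fun M v => by simp only [bq, hg]

theorem SD.ball {P : Pred (n + 1)} {F : Fam n} (hF : Rep F) (hP : SD .pi (i + 1) (n + 1) P) :
    SD .pi (i + 1) n fun M v => ∀ x ≤ F M v, P M (Fin.cons x v) := by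
  obtain ⟨g, hg⟩ := hF
  exact SD.congr (i := i + 1) (Blk.quant g hP) fun M v => by simp only [bq, hg]

theorem SD.sharp_bex {q' : Quant} {P : Pred (n + 1)} {F : Fam n} (hF : Rep F) (hP : SD q 0 (n + 1) P) :
    SD q' 0 n fun M v => ∃ x ≤ ln (F M v), P M (Fin.cons x v) := by
  obtain ⟨_, ⟨f, hf⟩, hP⟩ := hP
  have hb : Rep fun M v => 2 * F M v + 1 := by
    simpa only [one_add_one_eq_two] using ((Rep.one.add Rep.one).mul hF).add Rep.one
  refine (SD.le hb.ln ((Rep.ev (.minim f)).cons hb Rep.var)).not'.congr fun M v => ?_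
  rw [not_le, ← exists_lt_ln_iff]
  simp only [hP, hf, ln_bit1, lt_add_one_iff_model]

theorem SD.sharp_ball {q' : Quant} {P : Pred (n + 1)} {F : Fam n} (hF : Rep F) (hP : SD q 0 (n + 1) P) :
    SD q' 0 n fun M v => ∀ x ≤ ln (F M v), P M (Fin.cons x v) :=
  (SD.sharp_bex hF hP.not).not'.congr fun M v => by simp

/-- Least number principle for lengths. -/
theorem SD.exists_least {P : Pred (n + 1)} (hP : SD q 0 (n + 1) P) {M : Model} {v : Fin n → M}
    {b j : M} (hj : j ≤ ln b) (h : P M (Fin.cons j v)) :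
    ∃ j ≤ ln b, P M (Fin.cons j v) ∧ ∀ i < j, ¬ P M (Fin.cons i v) := by
  obtain ⟨_, ⟨f, hf⟩, hP⟩ := hP
  simp only [hP, hf] at h ⊢
  simp only [← lt_add_one_iff_model, ← ln_bit1] at hj ⊢
  have := (exists_lt_ln_iff f).1 ⟨j, hj, h⟩
  exact ⟨_, this, minim_spec f this, fun i hi => not_not.2 (minim_least f hi)⟩

end Predicates

/-! ### Strict formulas and predicates -/

section Correspondence

variable {α : Type} {m n i : ℕ} {q : Quant} {M : Model}

theorem realize_boundF {t : LTC.Term (α ⊕ Fin m)} {v : α → M} {xs : Fin m → M} {x : M} :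
    (boundF t).Realize v (Fin.snoc xs x) ↔ x ≤ t.realize (Sum.elim v xs) := by
  unfold boundF
  rw [BoundedFormula.realize_rel₂]
  simp only [Term.realize_var, Sum.elim_inr, Fin.snoc_last, Term.realize_relabel]
  rw [Sum.elim_comp_map, Fin.snoc_comp_castSucc]
  rfl

theorem realize_bEx {t : LTC.Term (α ⊕ Fin m)} {φ : LTC.BoundedFormula α (m + 1)} {v : α → M}
    {xs : Fin m → M} : (bEx t φ).Realize v xs ↔
      ∃ x ≤ t.realize (Sum.elim v xs), φ.Realize v (Fin.snoc xs x) := by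
  simp only [bEx, BoundedFormula.realize_ex, BoundedFormula.realize_inf, realize_boundF]

theorem realize_bAll {t : LTC.Term (α ⊕ Fin m)} {φ : LTC.BoundedFormula α (m + 1)} {v : α → M}
    {xs : Fin m → M} : (bAll t φ).Realize v xs ↔
      ∀ x ≤ t.realize (Sum.elim v xs), φ.Realize v (Fin.snoc xs x) := by
  simp only [bAll, BoundedFormula.realize_all, BoundedFormula.realize_imp, realize_boundF]

/-- The predicate defined by a formula, for an assignment of positions to its variables. -/
def predOf (φ : LTC.BoundedFormula α m) (e : α ⊕ Fin m → Fin n) : Pred n :=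
  fun _ w => φ.Realize (w ∘ e ∘ Sum.inl) (w ∘ e ∘ Sum.inr)

/-- Positions of the variables under a quantifier. -/
def liftPos (e : α ⊕ Fin m → Fin n) : α ⊕ Fin (m + 1) → Fin (n + 1) :=
  Sum.elim (Fin.succ ∘ e ∘ Sum.inl) (Fin.snoc (Fin.succ ∘ e ∘ Sum.inr) 0)

theorem predOf_liftPos {φ : LTC.BoundedFormula α (m + 1)} {e : α ⊕ Fin m → Fin n} {x : M}
    {w : Fin n → M} : predOf φ (liftPos e) M (Fin.cons x w) ↔
      φ.Realize (w ∘ e ∘ Sum.inl) (Fin.snoc (w ∘ e ∘ Sum.inr) x) := by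
  unfold predOf
  apply iff_of_eq
  congr 1
  ext j
  refine Fin.lastCases ?_ (fun j => ?_) j <;> simp [liftPos]

theorem Rep.term_bound (t : LTC.Term (α ⊕ Fin m)) (e : α ⊕ Fin m → Fin n) :
    Rep fun _ w => t.realize (Sum.elim (w ∘ e ∘ Sum.inl) (w ∘ e ∘ Sum.inr)) := by
  convert Rep.term t e using 4 with M w
  exact Sum.elim_comp_inl_inr (w ∘ e)

theorem IsSharp.sd {φ : LTC.BoundedFormula α m} (h : IsSharp φ) (e : α ⊕ Fin m → Fin n) :
    SD q 0 n (predOf φ e) := by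
  induction h generalizing n q with
  | atomic h =>
    cases h with
    | equal s t =>
      exact (SD.eq (Rep.term_bound s e) (Rep.term_bound t e)).congr fun M w => by
        rw [predOf, BoundedFormula.realize_bdEqual]
    | rel R ts =>
      cases R
      refine (SD.le (Rep.term_bound (ts 0) e) (Rep.term_bound (ts 1) e)).congr fun M w => ?_
      rw [predOf, BoundedFormula.realize_rel]
      apply iff_of_eq
      refine congrArg (Structure.RelMap (L := LTC) Rel.le) ?_
      ext j; fin_cases j <;> rfl
  | falsum =>
    exact ⟨_, Rep.zero, fun M v => by simp [predOf]⟩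
  | imp _ _ ih₁ ih₂ =>
    exact ((ih₁ e).not'.or (ih₂ e)).congr fun M v => by
      simp only [predOf, BoundedFormula.realize_imp, imp_iff_not_or]
  | @ex _ t φ _ ih =>
    exact (SD.sharp_bex (q := q) (Rep.term_bound t e) (ih (liftPos e))).congr fun M w => by
      simp only [predOf_liftPos]; simp only [predOf, realize_bEx, realize_len]
  | @all _ t φ _ ih =>
    exact (SD.sharp_ball (q := q) (Rep.term_bound t e) (ih (liftPos e))).congr fun M w => by
      simp only [predOf_liftPos]; simp only [predOf, realize_bAll, realize_len]

theorem IsStrict.sd {φ : LTC.BoundedFormula α m} (h : IsStrict q i φ) (e : α ⊕ Fin m → Fin n) :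
    SD q i n (predOf φ e) := by
  induction h generalizing n with
  | sharp h => exact h.sd e
  | block _ ih => exact (ih e).block
  | @ex _ _ t φ _ ih =>
    exact (SD.bex (Rep.term_bound t e) (ih (liftPos e))).congr fun M w => by
      simp only [predOf_liftPos]; simp only [predOf, realize_bEx]
  | @all _ _ t φ _ ih =>
    exact (SD.ball (Rep.term_bound t e) (ih (liftPos e))).congr fun M w => by
      simp only [predOf_liftPos]; simp only [predOf, realize_bAll]

/-- Converse of `IsStrict.sd`: it lets syntax be forgotten, since instances of schemes can be chosen
by giving a predicate in `SD q i`. -/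
theorem SD.exists_strict {P : Pred n} (h : SD q i n P) (σ : Fin n → α ⊕ Fin m) :
    ∃ φ : LTC.BoundedFormula α m, IsStrict q i φ ∧
      ∀ (M : Model) (v : α → M) xs, φ.Realize v xs ↔ P M (Sum.elim v xs ∘ σ) := by
  induction i generalizing q n m with
  | zero =>
    obtain ⟨_, ⟨f, hf⟩, h⟩ := h
    refine ⟨∼((Term.func (L := LTC) f (Term.var ∘ σ)).bdEqual 0),
      .sharp (.imp (.atomic (.equal _ _)) .falsum), fun M v xs => ?_⟩
    rw [BoundedFormula.realize_not, BoundedFormula.realize_bdEqual, h, hf, realize_zero,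
      realize_func]
    rfl
  | succ i ih =>
    simp only [SD] at h
    induction h generalizing m with
    | base h =>
      obtain ⟨φ, hφ, h⟩ := ih h σ
      exact ⟨φ, .block hφ, h⟩
    | @quant n P g _ ihP =>
      obtain ⟨φ, hφ, h⟩ := ihP (Fin.cons (Sum.inr (Fin.last m)) (Sum.map id Fin.castSucc ∘ σ))
      have key : ∀ (M : Model) (v : α → M) xs x, φ.Realize v (Fin.snoc xs x) ↔
          P M (Fin.cons x (Sum.elim v xs ∘ σ)) := fun M v xs x => by
        rw [h]
        apply iff_of_eq
        congr 1
        ext j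
        refine Fin.cases ?_ (fun j => ?_) j
        · simp
        · simp only [Function.comp_apply, Fin.cons_succ]
          rcases σ j with a | a <;> simp
      cases q
      · exact ⟨bEx (Term.func (L := LTC) g (Term.var ∘ σ)) φ, .ex hφ, fun M v xs => by
          rw [realize_bEx]
          simp only [key]
          rfl⟩
      · exact ⟨bAll (Term.func (L := LTC) g (Term.var ∘ σ)) φ, .all hφ, fun M v xs => by
          rw [realize_bAll]
          simp only [key]
          rfl⟩

end Correspondence

/-! ### Induction for sharply bounded predicates -/

section SharpInduction

variable {n m i : ℕ} {q : Quant} {M : Model}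

theorem SD.cons {P : Pred (m + 1)} (hP : SD q i (m + 1) P) {G : Fam n} (hG : Rep G)
    {H : Fin m → Fam n} (hH : ∀ j, Rep (H j)) :
    SD q i n fun M v => P M (Fin.cons (G M v) fun j => H j M v) := by
  refine (hP.subst (H := Fin.cons G H) (Fin.cases hG hH)).congr fun M v => ?_
  apply iff_of_eq
  congr 1
  ext j
  refine Fin.cases ?_ (fun j => ?_) j <;> rfl

theorem SD.lt {F G : Fam n} (hF : Rep F) (hG : Rep G) : SD q i n fun M v => F M v < G M v :=
  (SD.le hG hF).not'.congr fun _ _ => not_le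

/-- A least counterexample `j` below the length would be nonzero, and the step applied to `j - 1`
refutes it. -/
theorem lind {P : Pred (n + 1)} (hP : SD q 0 (n + 1) P) {v : Fin n → M}
    (h0 : P M (Fin.cons 0 v)) (hs : ∀ x, P M (Fin.cons x v) → P M (Fin.cons (x + 1) v))
    {b j : M} (hj : j ≤ ln b) : P M (Fin.cons j v) := by
  by_contra h
  obtain ⟨j, -, hj, hlt⟩ := SD.exists_least (hP.not) hj h
  have hj0 : 0 < j := pos_iff_ne_zero.2 fun h => hj (h ▸ h0)
  have hj1 : j - 1 + 1 = j := sub_add_model (one_le_iff.2 hj0)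
  refine hj ?_
  rw [← hj1]
  exact hs _ (not_not.1 (hlt _ (succ_le_iff.1 hj1.le)))

theorem hf_eq_iff {x y : M} : hf y = x ↔ 2 * x = y ∨ 2 * x + 1 = y := by
  have := realize_basic M .half_iff ![x, y, 0, 0]
  simp [one_add_one_eq_two] at this
  rw [eq_comm, this]

theorem two_mul_hf (x : M) : 2 * hf x = x ∨ 2 * hf x + 1 = x := hf_eq_iff.1 rfl

theorem hf_bit0 (x : M) : hf (2 * x) = x := hf_eq_iff.2 (.inl rfl)

theorem hf_bit1 (x : M) : hf (2 * x + 1) = x := hf_eq_iff.2 (.inr rfl)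

theorem hf_zero : hf (0 : M) = 0 := by simpa using hf_bit0 (0 : M)

theorem two_mul_hf_le (x : M) : 2 * hf x ≤ x := by
  rcases two_mul_hf x with h | h
  · exact h.le
  · nth_rw 2 [← h]
    exact le_self_add

theorem le_two_mul_hf (x : M) : x ≤ 2 * hf x + 1 := by
  rcases two_mul_hf x with h | h
  · nth_rw 1 [← h]
    exact le_self_add
  · exact h.ge

theorem hf_add (a r : M) : hf (2 * a + r) = a + hf r := by
  rw [hf_eq_iff, mul_add, add_assoc, add_right_inj, add_right_inj]
  exact two_mul_hf r

theorem ln_hf {x : M} (h : x ≠ 0) : ln x = ln (hf x) + 1 := by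
  simpa [h] using realize_basic M .len_half ![x, 0, 0, 0]

theorem ln_eq_zero {x : M} : ln x = 0 ↔ x = 0 := by
  refine ⟨fun h => ?_, fun h => by rw [h, ln_zero]⟩
  by_contra h'
  rw [ln_hf h'] at h
  simp at h

theorem ln_mono {x y : M} (h : x ≤ y) : ln x ≤ ln y := by
  simpa [h] using realize_basic M .len_mono ![x, y, 0, 0]

theorem ln_hf_eq (x : M) : ln (hf x) = ln x - 1 := by
  by_cases h : x = 0
  · simp [h, hf_zero, ln_zero]
  · rw [ln_hf h, add_tsub_cancel_right]

theorem ms_zero (x : M) : ms x 0 = x := by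
  simpa using realize_basic M .msp_zero ![x, 0, 0, 0]

theorem ms_succ (x y : M) : ms x (y + 1) = hf (ms x y) := by
  simpa using realize_basic M .msp_succ ![x, y, 0, 0]

theorem ms_of_ln_le {x y : M} (h : ln x ≤ y) : ms x y = 0 := by
  simpa [h] using realize_basic M .msp_large ![x, y, 0, 0]

theorem ms_sub_succ (a k x : M) : ms a (k - x) = ms a (k - (x + 1)) ∨
    ms a (k - x) = hf (ms a (k - (x + 1))) := by
  rcases le_or_gt k x with h | h
  · left
    rw [sub_of_le h, sub_of_le (h.trans le_self_add)]
  · right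
    rw [← ms_succ, tsub_add_eq_tsub_tsub, sub_add_model]
    rw [one_le_iff]
    exact tsub_pos_of_lt h

/-- Length induction on the number `x` of leading bits of `a` retained: the prefix `⌊a/2^(|a| ∸ x)⌋`
grows from 0 to `a`, one bit at a time. -/
theorem pind {P : Pred (n + 1)} (hP : SD q 0 (n + 1) P) {v : Fin n → M}
    (h0 : P M (Fin.cons 0 v)) (hs : ∀ x, x ≠ 0 → P M (Fin.cons (hf x) v) → P M (Fin.cons x v))
    (a : M) : P M (Fin.cons a v) := by
  have hQ : SD q 0 (n + 1 + 1) fun M w =>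
      P M (Fin.cons (ms (w 1) (ln (w 1) - w 0)) fun j => w j.succ.succ) :=
    hP.cons ((Rep.var 1).ms ((Rep.var 1).ln.sub (Rep.var 0))) fun j => Rep.var _
  have hs' : ∀ x, P M (Fin.cons (hf x) v) → P M (Fin.cons x v) := fun x hx => by
    by_cases h : x = 0
    · rwa [h]
    · exact hs x h hx
  have := lind hQ (M := M) (v := Fin.cons a v) ?_ ?_ (le_refl (ln a))
  · simpa [ms_zero] using this
  · simpa [ms_of_ln_le] using h0
  · intro x hx
    simp only [Fin.cons_zero, Fin.cons_one, Fin.cons_succ] at hx ⊢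
    rcases ms_sub_succ a (ln a) x with h | h <;> rw [h] at hx
    exacts [hx, hs' _ hx]

end SharpInduction

/-! ### Powers of two and shifts -/

section Powers

variable {M : Model}

/-- `2^|x|` -/
def pw (x : M) : M := sm 1 x

theorem Rep.pw {n : ℕ} {F : Fam n} (hF : Rep F) : Rep fun M v => pw (F M v) := Rep.one.sm hF

theorem ln_sm (x y : M) : ln (sm x y) = ln x * ln y + 1 := by
  simpa using realize_basic M .len_smash ![x, y, 0, 0]

theorem ln_pw (x : M) : ln (pw x) = ln x + 1 := by
  rw [pw, ln_sm, ln_one, one_mul]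

theorem sm_comm (x y : M) : sm x y = sm y x := by
  simpa using realize_basic M .smash_comm ![x, y, 0, 0]

theorem pw_congr {x y : M} (h : ln x = ln y) : pw x = pw y := by
  have := realize_basic M .smash_congr ![x, y, 1, 0]
  simpa [h, sm_comm _ (1 : M), pw] using this

theorem pw_add {x y z : M} (h : ln x = ln y + ln z) : pw x = pw y * pw z := by
  have := realize_basic M .smash_add ![x, y, z, 1]
  simpa [h, sm_comm _ (1 : M), pw] using this

theorem pw_zero : pw (0 : M) = 1 := by
  rw [pw, sm_comm]
  simpa using realize_basic M .zero_smash ![0, 1, 0, 0]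

theorem pw_pos (x : M) : 0 < pw x := by
  rw [pos_iff_ne_zero]
  intro h
  have := ln_pw x
  rw [h, ln_zero] at this
  exact absurd this.symm (by simp)

theorem one_sm_bits {x : M} (h : x ≠ 0) :
    sm 1 (2 * x) = 2 * sm 1 x ∧ sm 1 (2 * x + 1) = 2 * sm 1 x := by
  simpa [h, one_add_one_eq_two] using realize_basic M .one_smash ![x, 0, 0, 0]

theorem pw_one : pw (1 : M) = 2 := by
  have h := (one_sm_bits (M := M) one_ne_zero).1
  have hl : ln (2 * 1 : M) = ln 1 + ln 1 := by
    rw [ln_hf (by simp), hf_bit0, ln_one]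
  have h' := pw_add hl
  -- The value `1 # 2` is computed twice, by additivity in the length and by the doubling axiom;
  -- cancelling `1 # 1` gives its value.
  have h'' : pw (1 : M) * pw 1 = 2 * pw 1 := by rw [← h', pw, h]; rfl
  exact mul_right_cancel₀ (pw_pos _).ne' h''

theorem pw_hf {x : M} (h : x ≠ 0) : pw x = 2 * pw (hf x) := by
  by_cases h' : hf x = 0
  · rcases two_mul_hf x with hx | hx
    · simp [h', h.symm] at hx
    · simp [h'] at hx
      rw [h', ← hx, pw_zero, pw_one, mul_one]
  · rcases two_mul_hf x with hx | hx
    · nth_rw 1 [← hx]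
      exact (one_sm_bits h').1
    · nth_rw 1 [← hx]
      exact (one_sm_bits h').2

theorem pw_bit1 (x : M) : pw (2 * x + 1) = 2 * pw x := by
  rw [pw_hf (by simp), hf_bit1]

theorem pw_lt {x y : M} (h : ln x < ln y) : pw x < pw y :=
  not_le.1 fun h' => by
    have := ln_mono h'
    rw [ln_pw, ln_pw, add_le_add_iff_right] at this
    exact this.not_gt h

theorem pw_mono {x y : M} (h : ln x ≤ ln y) : pw x ≤ pw y :=
  h.lt_or_eq.elim (fun h => (pw_lt h).le) fun h => (pw_congr h).le

theorem lt_pw (x : M) : x < pw x :=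
  not_le.1 fun h' => by
    have := ln_mono h'
    rw [ln_pw, succ_le_iff] at this
    exact this.false

/-- For `x ≠ 0`, `pw (hf x)` is `2^(|x| - 1)`, the weight of the leading bit. With `lt_pw` this ties
the length to the size of a number. -/
theorem pw_hf_le {x : M} (hx : x ≠ 0) : pw (hf x) ≤ x := by
  have hS : SD .sigma 0 1 fun M v => v 0 = 0 ∨ pw (hf (v 0)) ≤ v 0 :=
    (SD.eq (Rep.var 0) Rep.zero).or (SD.le (Rep.var 0).hf.pw (Rep.var 0))
  have := pind hS (M := M) (v := ![]) (.inl rfl) (fun x hx ih => .inr ?_) x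
  · exact this.resolve_left hx
  · simp only [Fin.cons_zero] at ih ⊢
    rcases ih with h | h
    · rw [h, pw_zero, one_le_iff]
      exact pos_iff_ne_zero.2 hx
    · by_cases h' : hf x = 0
      · rw [h', pw_zero, one_le_iff]
        exact pos_iff_ne_zero.2 hx
      · rw [pw_hf h']
        exact (mul_le_mul_right h 2).trans (two_mul_hf_le x)

theorem ln_le_of_lt_pw {x t : M} (h : x < pw t) : ln x ≤ ln t := by
  by_contra! h'
  have hx : x ≠ 0 := by
    rintro rfl
    simp [ln_zero] at h'
  rw [ln_hf hx, lt_add_one_iff_model] at h'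
  exact h.not_ge ((pw_mono h').trans (pw_hf_le hx))

theorem ln_eq_of_pw_le {x t : M} (h : pw t ≤ x) (h' : x < 2 * pw t) : ln x = ln t + 1 := by
  refine le_antisymm ?_ (ln_pw t ▸ ln_mono h)
  rw [← ln_bit1]
  exact ln_le_of_lt_pw (by rwa [pw_bit1])

theorem ln_ms {z b j : M} (h : j ≤ ln b) : ln (ms z j) = ln z - j := by
  have hS : SD .sigma 0 2 fun M v => ln (ms (v 1) (v 0)) = ln (v 1) - v 0 :=
    SD.eq ((Rep.var 1).ms (Rep.var 0)).ln ((Rep.var 1).ln.sub (Rep.var 0))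
  refine lind hS (v := ![z]) ?_ (fun x ih => ?_) h
  · simp [ms_zero]
  · simp only [Fin.cons_zero, Fin.cons_one, Matrix.cons_val_zero] at ih ⊢
    rw [ms_succ, ln_hf_eq, ih, tsub_add_eq_tsub_tsub]

/-- `⌊z/2^|u|⌋` -/
def dv (z u : M) : M := ms z (ln u)

/-- `z mod 2^|u|` -/
def md (z u : M) : M := z - dv z u * pw u

theorem dv_hf {z u : M} (h : u ≠ 0) : dv z u = hf (dv z (hf u)) := by
  rw [dv, ln_hf h, ms_succ]; rfl

theorem dv_bounds (z u : M) : dv z u * pw u ≤ z ∧ z < (dv z u + 1) * pw u := by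
  have hd : Rep (n := 2) fun M v => dv (v 1) (v 0) := (Rep.var 1).ms (Rep.var 0).ln
  have hS : SD .sigma 0 2 fun M v => dv (v 1) (v 0) * pw (v 0) ≤ v 1 ∧
      v 1 < (dv (v 1) (v 0) + 1) * pw (v 0) :=
    (SD.le (hd.mul (Rep.var 0).pw) (Rep.var 1)).and
      (SD.lt (Rep.var 1) ((hd.add Rep.one).mul (Rep.var 0).pw))
  refine pind hS (v := ![z]) ?_ (fun x hx ih => ?_) u
  · simp only [Fin.cons_zero, Fin.cons_one, Matrix.cons_val_zero, pw_zero, mul_one, dv, ln_zero,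
      ms_zero, le_refl, true_and]
    exact lt_add_one_iff_model.2 le_rfl
  · simp only [Fin.cons_zero, Fin.cons_one, Matrix.cons_val_zero] at ih ⊢
    rw [dv_hf hx, pw_hf hx]
    generalize dv z (hf x) = a at *
    generalize pw (hf x) = p at *
    constructor
    · refine le_trans ?_ ih.1
      rw [← mul_assoc, mul_comm (hf a)]
      exact mul_le_mul_left (two_mul_hf_le a) p
    · refine ih.2.trans_le ?_
      rw [← mul_assoc]
      refine mul_le_mul_left ?_ p
      rw [add_mul, one_mul, ← one_add_one_eq_two, ← add_assoc, one_add_one_eq_two, mul_comm]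
      exact add_le_add_left (le_two_mul_hf a) 1

theorem dv_unique {z u q : M} (h : q * pw u ≤ z) (h' : z < (q + 1) * pw u) : dv z u = q := by
  have key : ∀ a b : M, a * pw u ≤ z → z < (b + 1) * pw u → a ≤ b := fun a b ha hb =>
    lt_add_one_iff_model.1 (lt_of_mul_lt_mul_right (ha.trans_lt hb) zero_le)
  exact le_antisymm (key _ _ (dv_bounds z u).1 h') (key _ _ h (dv_bounds z u).2)

theorem dv_mul_add_md (z u : M) : dv z u * pw u + md z u = z := by
  rw [md, add_tsub_cancel_of_le (dv_bounds z u).1]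

theorem md_lt (z u : M) : md z u < pw u := by
  have := (dv_bounds z u).2
  nth_rw 1 [← dv_mul_add_md z u] at this
  rwa [add_mul, one_mul, add_lt_add_iff_left] at this

theorem dv_md_unique {z u q r : M} (h : q * pw u + r = z) (hr : r < pw u) :
    dv z u = q ∧ md z u = r := by
  have hd : dv z u = q := dv_unique (h ▸ le_self_add) (by
    rwa [← h, add_mul, one_mul, add_lt_add_iff_left])
  refine ⟨hd, ?_⟩
  rw [md, hd, ← h, add_tsub_cancel_left]

end Powers

/-! ### Coding of tuples compatible with successor and halving

A number `z` with `2^m ≤ |z| < 2^(m+1)` is split into its `2^m` leading bits, which code the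
parameters, and the remaining low bits, which represent the induction variable. -/

section Coding

variable {M : Model}

/-- The largest power of two not exceeding `n ≠ 0`. -/
def topPow (n : M) : M := pw (hf n)

/-- A number whose length is the number of low bits of `z`. -/
def lowLen (z : M) : M := ms z (topPow (ln z))

/-- The low part of `z`. -/
def low (z : M) : M := md z (lowLen z)

/-- The leading part of `z`. -/
def high (z : M) : M := dv z (lowLen z)

/-- The leading part of `z` without its leading bit. -/
def rest (z : M) : M := high z - pw (hf (high z))

theorem Rep.lowLen {n : ℕ} {F : Fam n} (hF : Rep F) : Rep fun M v => lowLen (F M v) :=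
  hF.ms hF.ln.hf.pw

theorem Rep.high {n : ℕ} {F : Fam n} (hF : Rep F) : Rep fun M v => high (F M v) :=
  hF.ms hF.lowLen.ln

theorem Rep.low {n : ℕ} {F : Fam n} (hF : Rep F) : Rep fun M v => low (F M v) :=
  hF.sub (hF.high.mul hF.lowLen.pw)

theorem Rep.rest {n : ℕ} {F : Fam n} (hF : Rep F) : Rep fun M v => rest (F M v) :=
  hF.high.sub hF.high.hf.pw

theorem Rep.iterate_rest {n : ℕ} {F : Fam n} (hF : Rep F) (k : ℕ) :
    Rep fun M v => TC0Arith.rest^[k] (F M v) := by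
  induction k with
  | zero => exact hF
  | succ k ih => simpa only [Function.iterate_succ_apply'] using ih.rest

theorem ln_lowLen {z : M} (h : z ≠ 0) : ln (lowLen z) = ln z - topPow (ln z) :=
  ln_ms (pw_hf_le (mt ln_eq_zero.1 h))

theorem low_zero : low (0 : M) = 0 := by
  rw [low, md, zero_tsub]

theorem dv_congr {z u u' : M} (h : ln u = ln u') : dv z u = dv z u' := by
  rw [dv, h]; rfl

theorem md_congr {z u u' : M} (h : ln u = ln u') : md z u = md z u' := by
  rw [md, dv_congr h, pw_congr h]; rfl

theorem rest_congr {z z' : M} (h : high z = high z') : rest z = rest z' := by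
  rw [rest, h]; rfl

/-- If the length does not change, the cut stays in place, and the increment either remains in the
low part or overflows it to 0. If the length grows, `z + 1` is a power of two, whose low bits
vanish. -/
theorem low_succ (z : M) : low (z + 1) = 0 ∨ low (z + 1) = low z + 1 ∧ rest (z + 1) = rest z := by
  rcases (succ_le_iff.2 (lt_pw z)).lt_or_eq with h | h
  · have hz : z ≠ 0 := by
      rintro rfl
      simp [pw_zero] at h
    have hl : ln (z + 1) = ln z := le_antisymm (ln_le_of_lt_pw h) (ln_mono le_self_add)
    have hu : ln (lowLen (z + 1)) = ln (lowLen z) := by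
      rw [ln_lowLen hz, ln_lowLen (by simp), hl]
    have hlow : low (z + 1) = md (z + 1) (lowLen z) := md_congr hu
    have hhigh : high (z + 1) = dv (z + 1) (lowLen z) := dv_congr hu
    have hz' := dv_mul_add_md z (lowLen z)
    rcases (succ_le_iff.2 (md_lt z (lowLen z))).lt_or_eq with h | h
    · obtain ⟨h₁, h₂⟩ := dv_md_unique (z := z + 1) (by rw [← add_assoc, hz']) h
      exact .inr ⟨hlow.trans h₂, rest_congr (hhigh.trans h₁)⟩
    · left
      rw [hlow]
      refine (dv_md_unique (q := dv z (lowLen z) + 1) ?_ (pw_pos _)).2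
      nth_rw 4 [← hz']
      rw [add_assoc, h, add_mul, one_mul, add_zero]
  · left
    rw [h]
    have hu : ln (lowLen (pw z)) ≤ ln z := by
      rw [ln_lowLen (pw_pos z).ne', ln_pw, tsub_le_iff_right, add_le_add_iff_left, one_le_iff]
      exact pw_pos _
    -- The exponent of the quotient is `|z|` minus the number of low bits, so the product of the two
    -- powers is `2^|z|`.
    refine (dv_md_unique (q := pw (ms z (ln (lowLen (pw z))))) ?_ (pw_pos _)).2
    rw [add_zero]
    refine (pw_add ?_).symm
    rw [ln_ms le_rfl, tsub_add_cancel_of_le hu]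

/-- As long as there are low bits, `|z|` exceeds `2^m`, so dropping the last bit keeps the same `m`:
the leading part is unchanged and the low part is halved. With no low bits, `low z = 0`. -/
theorem low_hf (z : M) : low z = 0 ∨ low (hf z) = hf (low z) ∧ rest (hf z) = rest z := by
  by_cases hz : z = 0
  · exact .inl (by rw [hz, low_zero])
  by_cases hu : lowLen z = 0
  · left
    rw [low, hu, md, dv, ln_zero, ms_zero, pw_zero, mul_one, tsub_self]
  right
  have hn := ln_hf hz
  have hlt : topPow (ln z) ≤ ln (hf z) := by
    rw [← lt_add_one_iff_model, ← hn, ← tsub_pos_iff_lt, ← ln_lowLen hz, pos_iff_ne_zero]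
    exact mt ln_eq_zero.1 hu
  have hln : ln (ln (hf z)) = ln (ln z) := by
    refine le_antisymm (ln_mono (hn ▸ le_self_add)) ?_
    rw [ln_hf (mt ln_eq_zero.1 hz), ← ln_pw]
    exact ln_mono hlt
  have htop : topPow (ln (hf z)) = topPow (ln z) :=
    pw_congr (by rw [ln_hf_eq (ln (hf z)), ln_hf_eq (ln z), hln])
  have hz' : hf z ≠ 0 := by
    intro h
    rw [h, ln_zero] at hlt
    exact (pw_pos _).not_ge hlt
  have hu' : ln (lowLen (hf z)) = ln (hf (lowLen z)) := by
    rw [ln_lowLen hz', htop, ln_hf_eq (lowLen z), ln_lowLen hz, hn, tsub_right_comm, add_tsub_cancel_right]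
  have key := dv_md_unique (z := hf z) (u := hf (lowLen z)) (q := high z) (r := hf (low z)) ?_ ?_
  · exact ⟨(md_congr hu').trans key.2, rest_congr ((dv_congr hu').trans key.1)⟩
  · rw [← hf_add, mul_left_comm, ← pw_hf hu]
    exact congrArg hf (dv_mul_add_md z (lowLen z))
  · have := (two_mul_hf_le (low z)).trans_lt (md_lt z (lowLen z))
    rw [pw_hf hu] at this
    exact lt_of_mul_lt_mul_left this zero_le

theorem ln_two : ln (2 : M) = 2 := by
  have := ln_pw (1 : M)
  rwa [pw_one, ln_one, one_add_one_eq_two] at this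

theorem exists_low_rest (x c : M) : ∃ z, low z = x ∧ rest z = c := by
  let s := max x c + 1
  have hs : s ≠ 0 := by simp [s]
  have hk : ln s ≠ 0 := mt ln_eq_zero.1 hs
  -- The length of the leading part, a power of two large enough that `x` and `c` fit into `L - 1`
  -- bits.
  let L := pw (ln s)
  have hL : L - 1 + 1 = L := sub_add_model (one_le_iff.2 (pw_pos _))
  -- This makes `L - 1` a length in the model: it is below `|s # 2| = 2|s| + 1`.
  have hL' : L ≤ 2 * ln s := by
    rw [show L = _ from pw_hf hk]
    exact mul_le_mul_right (pw_hf_le hk) 2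
  obtain ⟨t, ht⟩ : ∃ t, ln t = L - 1 := by
    have hB : L - 1 ≤ ln (sm s 2) := by
      rw [ln_sm, ln_two, mul_comm]
      exact tsub_le_self.trans (hL'.trans le_self_add)
    exact ⟨ms (sm s 2) (ln (sm s 2) - (L - 1)), by
      rw [ln_ms tsub_le_self, tsub_tsub_cancel_of_le hB]⟩
  have hst : ln s ≤ ln t := by
    rw [ht, ← lt_add_one_iff_model, hL]
    exact lt_pw _
  have hx : x < pw t := (lt_pw x).trans_le
    (pw_mono ((ln_mono ((le_max_left x c).trans le_self_add)).trans hst))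
  have hc : c < pw t := (lt_pw c).trans_le
    (pw_mono ((ln_mono ((le_max_right x c).trans le_self_add)).trans hst))
  obtain ⟨T, hT⟩ : ∃ T, ln T = ln t + ln t :=
    ⟨hf (sm t 2), by rw [ln_hf_eq, ln_sm, ln_two, add_tsub_cancel_right, mul_two]⟩
  have hpT := pw_add hT
  -- In binary: a leading 1, then `c` and `x` padded to `|t| = L - 1` bits each. The total length
  -- `2L - 1` lies in `[L, 2L)`, so the cut falls after the first `L` bits.
  let z := (pw t + c) * pw t + x
  have hz : ln z = ln t + ln t + 1 := by
    rw [← hT]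
    refine ln_eq_of_pw_le ?_ ?_
    · rw [hpT]
      exact (mul_le_mul_left le_self_add _).trans le_self_add
    · calc z < (pw t + c) * pw t + pw t := (add_lt_add_iff_left _).2 hx
        _ = (pw t + (c + 1)) * pw t := by ring
        _ ≤ (pw t + pw t) * pw t :=
          mul_le_mul_left (add_le_add_right (succ_le_iff.2 hc) _) _
        _ = 2 * pw T := by rw [hpT]; ring
  have hz0 : z ≠ 0 := fun h => by
    rw [h, ln_zero] at hz
    exact absurd hz.symm (by simp)
  have htop : topPow (ln z) = L := by
    refine pw_congr ?_
    rw [hz, ← two_mul, hf_bit1, ht]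
    refine le_antisymm (ln_le_of_lt_pw (succ_le_iff.1 hL.le)) ?_
    rw [ln_hf hk, ← ln_pw]
    refine ln_mono ?_
    rw [← add_le_add_iff_right (1 : M), hL, show L = _ from pw_hf hk, two_mul]
    exact add_le_add_right (one_le_iff.2 (pw_pos _)) _
  have hu : ln (lowLen z) = ln t := by
    rw [ln_lowLen hz0, htop, hz, add_assoc, ht, hL, add_tsub_cancel_right]
  obtain ⟨h₁, h₂⟩ := dv_md_unique (z := z) rfl hx
  have hhigh : high z = pw t + c := (dv_congr hu).trans h₁
  refine ⟨z, (md_congr hu).trans h₂, ?_⟩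
  have : ln (pw t + c) = ln t + 1 := by
    refine ln_eq_of_pw_le le_self_add ?_
    rw [two_mul]
    exact (add_lt_add_iff_left _).2 hc
  rw [rest, hhigh, pw_congr (x := hf (pw t + c)) (y := t) (by rw [ln_hf_eq, this, add_tsub_cancel_right]),
    add_tsub_cancel_left]

theorem exists_code {n : ℕ} (v : Fin n → M) : ∃ z : M, ∀ j : Fin n, low (rest^[j] z) = v j := by
  induction n with
  | zero => exact ⟨0, fun j => j.elim0⟩
  | succ n ih =>
    obtain ⟨c, hc⟩ := ih fun j => v j.succ
    obtain ⟨z, hz, hz'⟩ := exists_low_rest (v 0) c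
    refine ⟨z, Fin.cases hz fun j => ?_⟩
    rw [Fin.val_succ, Function.iterate_succ_apply, hz', hc]

end Coding

/-! ### Semantics of induction schemes and rules -/

section Rules

/-- The class of strict formulas with a given quantifier type and number of blocks. -/
def strictClass (q : Quant) (i : ℕ) : FormulaClass := fun _ => {φ | IsStrict q i φ}

variable {s s' : IndKind} {q q' : Quant} {i i' k n : ℕ} {M : Model}

/-- The induction step for a predicate on a model. -/
def Step : IndKind → (M → Prop) → M → Prop
  | .ind, p, x => p x → p (x + 1)
  | .pind, p, x => p (hf x) → p x

/-- The predicate defined by a formula, the distinguished variable coming first. -/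
def indPred (φ : IndFormula k) : Pred (k + 1) :=
  predOf φ (Sum.elim (Sum.elim Fin.succ fun _ => 0) Fin.elim0)

theorem indPred_cons {φ : IndFormula k} {x : M} {v : Fin k → M} :
    indPred φ M (Fin.cons x v) ↔ φ.Realize (Sum.elim v fun _ => x) := by
  unfold indPred predOf Formula.Realize
  apply iff_of_eq
  congr 1
  · ext (a | a) <;> simp
  · exact Subsingleton.elim _ _

theorem exists_indPred_eq {P : Pred (k + 1)} (hP : SD q i (k + 1) P) :
    ∃ φ ∈ strictClass q i k, indPred φ = P := by
  obtain ⟨φ, hφ, h⟩ := hP.exists_strict (α := Fin k ⊕ Fin 1) (m := 0)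
    (Fin.cons (Sum.inl (Sum.inr 0)) (Sum.inl ∘ Sum.inl))
  refine ⟨φ, hφ, funext fun M => funext fun w => propext ?_⟩
  rw [indPred, predOf, h]
  apply iff_of_eq
  congr 1
  ext j
  refine Fin.cases ?_ (fun j => ?_) j <;> rfl

theorem models_baseF {φ : IndFormula k} :
    M ⊨ univ (baseF φ) ↔ ∀ v, indPred φ M (Fin.cons 0 v) := by
  simp only [realize_univ, baseF, realize_atTerm, indPred_cons, realize_zero, Function.comp_id]

theorem realize_stepF {φ : IndFormula k} {v : Fin k → M} {x : M} :
    (stepF s φ).Realize (Sum.elim v fun _ => x) ↔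
      Step s (fun x => indPred φ M (Fin.cons x v)) x := by
  cases s
  · simp only [stepF, realize_imp', realize_atTerm, Step, indPred_cons, realize_add, realize_one]
    rfl
  · simp only [stepF, realize_imp', realize_atTerm, Step, indPred_cons, realize_half]
    rfl

theorem models_stepF {φ : IndFormula k} : M ⊨ univ (allX (stepF s φ)) ↔
    ∀ v x, Step s (fun x => indPred φ M (Fin.cons x v)) x := by
  simp only [realize_univ, realize_allX, realize_stepF]

theorem models_allX {φ : IndFormula k} :
    M ⊨ univ (allX φ) ↔ ∀ v x, indPred φ M (Fin.cons x v) := by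
  simp only [realize_univ, realize_allX, indPred_cons]

theorem models_indAxiom {φ : IndFormula k} : M ⊨ indAxiom s φ ↔
    ∀ v, indPred φ M (Fin.cons 0 v) → (∀ x, Step s (fun x => indPred φ M (Fin.cons x v)) x) →
      ∀ x, indPred φ M (Fin.cons x v) := by
  simp only [indAxiom, realize_univ, realize_imp', realize_inf', realize_allX, realize_stepF,
    baseF, realize_atTerm, indPred_cons, realize_zero, Function.comp_id, and_imp]

/-- `M` satisfies the conclusions of the instances of `R` with premises provable in `T`. -/
def Sat (T : LTC.Theory) (R : Rule) (M : Model) : Prop :=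
  ∀ Δ ψ, (Δ, ψ) ∈ R → (∀ γ ∈ Δ, ∀ N : Model, N ⊨ T → N ⊨ γ) → M ⊨ ψ

theorem models_iff {T : LTC.Theory} (hT : BTC ⊆ T) {φ : LTC.Sentence} :
    T ⊨ᵇ φ ↔ ∀ M : Model, M ⊨ T → M ⊨ φ := by
  rw [Theory.models_sentence_iff]
  exact ⟨fun h M hM => h (.of T M), fun h N => h (N.subtheoryModel hT) N.is_model⟩

/-- A model of `T` with the conclusions of `S` must satisfy those of `R`. Only the provability of
premises refers to the other models of `T`. -/
theorem reducible_of {R S : Rule}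
    (h : ∀ T : LTC.Theory, ∀ M : Model, M ⊨ T → Sat T S M → Sat T R M) : R ≤ᵣ S := by
  intro T hT φ hφ
  have hsub : ∀ A : LTC.Theory, BTC ⊆ T ∪ A := fun A => hT.trans Set.subset_union_left
  refine (models_iff (hsub _)).2 fun M hM => (models_iff (hsub _)).1 hφ M ?_
  rw [Theory.model_union_iff] at hM ⊢
  refine ⟨hM.1, ⟨?_⟩⟩
  rintro ψ ⟨Δ, hR, hΔ⟩
  refine h T M hM.1 (fun Δ ψ hS hΔ => ?_) Δ ψ hR fun γ hγ => (models_iff hT).1 (hΔ γ hγ)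
  exact hM.2.realize_of_mem ψ ⟨Δ, hS, fun γ hγ => (models_iff hT).2 (hΔ γ hγ)⟩

/-- The induction axioms with parameters hold in `M`. -/
def AxHolds (s : IndKind) (q : Quant) (i : ℕ) (M : Model) : Prop :=
  ∀ ⦃n : ℕ⦄ (P : Pred (n + 1)), SD q i (n + 1) P → ∀ v, P M (Fin.cons 0 v) →
    (∀ x, Step s (fun x => P M (Fin.cons x v)) x) → ∀ x, P M (Fin.cons x v)

/-- The premises of the induction rule hold in `M`. -/
def Prem (s : IndKind) (P : Pred (n + 1)) (M : Model) : Prop :=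
  ∀ v, P M (Fin.cons 0 v) ∧ ∀ x, Step s (fun x => P M (Fin.cons x v)) x

/-- The parameter-free induction axioms hold in `M`. -/
def PFHolds (s : IndKind) (q : Quant) (i : ℕ) (M : Model) : Prop :=
  ∀ P : Pred 1, SD q i 1 P → Prem s P M → ∀ x, P M x

/-- The conclusions of the induction rule over `T` hold in `M`. -/
def RuleHolds (T : LTC.Theory) (s : IndKind) (q : Quant) (i : ℕ) (M : Model) : Prop :=
  ∀ ⦃n : ℕ⦄ (P : Pred (n + 1)), SD q i (n + 1) P → (∀ N : Model, N ⊨ T → Prem s P N) → ∀ x, P M x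

theorem sat_scheme {T : LTC.Theory} : Sat T (Scheme s (strictClass q i)) M ↔ AxHolds s q i M := by
  constructor
  · intro h n P hP
    obtain ⟨φ, hφ, rfl⟩ := exists_indPred_eq hP
    exact models_indAxiom.1 (h ∅ _ ⟨n, φ, hφ, rfl⟩ (by simp))
  · rintro h Δ ψ ⟨n, φ, hφ, heq⟩ -
    cases heq
    exact models_indAxiom.2 (h _ (IsStrict.sd hφ _))

theorem forall_cons_iff {p : (Fin (n + 1) → M) → Prop} :
    (∀ v x, p (Fin.cons x v)) ↔ ∀ w, p w :=
  ⟨fun h w => Fin.cons_self_tail w ▸ h _ _, fun h _ _ => h _⟩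

theorem sat_schemePF {T : LTC.Theory} :
    Sat T (SchemePF s (strictClass q i)) M ↔ PFHolds s q i M := by
  constructor
  · intro h P hP hprem
    obtain ⟨φ, hφ, rfl⟩ := exists_indPred_eq hP
    exact forall_cons_iff.1 fun v =>
      models_indAxiom.1 (h ∅ _ ⟨φ, hφ, rfl⟩ (by simp)) v (hprem v).1 (hprem v).2
  · rintro h Δ ψ ⟨φ, hφ, heq⟩ -
    cases heq
    refine models_indAxiom.2 fun v h0 hs x => h _ (IsStrict.sd hφ _) (fun v' => ?_) _
    obtain rfl := Subsingleton.elim v v'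
    exact ⟨h0, hs⟩

theorem sat_indRule {T : LTC.Theory} :
    Sat T (IndRule s (strictClass q i)) M ↔ RuleHolds T s q i M := by
  classical
  have key : ∀ {k} (φ : IndFormula k), (∀ γ ∈ (indInstance s φ).1, ∀ N : Model, N ⊨ T → N ⊨ γ) ↔
      ∀ N : Model, N ⊨ T → Prem s (indPred φ) N := by
    intro k φ
    simp only [indInstance, Finset.mem_insert, Finset.mem_singleton, forall_eq_or_imp, forall_eq,
      models_baseF, models_stepF, Prem]
    exact ⟨fun h N hN v => ⟨h.1 N hN v, h.2 N hN v⟩,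
      fun h => ⟨fun N hN v => (h N hN v).1, fun N hN v => (h N hN v).2⟩⟩
  constructor
  · intro h n P hP hprem
    obtain ⟨φ, hφ, rfl⟩ := exists_indPred_eq hP
    exact forall_cons_iff.1 (models_allX.1 (h _ _ ⟨n, φ, hφ, rfl⟩ ((key φ).2 hprem)))
  · rintro h Δ ψ ⟨n, φ, hφ, heq⟩ hΔ
    cases heq
    exact models_allX.2 (forall_cons_iff.2 (h _ (IsStrict.sd hφ _) ((key φ).1 hΔ)))

/-- Uniform translation of the premises and the conclusion of one induction rule to another. -/
def Translates (s : IndKind) (q : Quant) (i : ℕ) (s' : IndKind) (q' : Quant) (i' : ℕ) : Prop :=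
  ∀ ⦃n : ℕ⦄ (P : Pred (n + 1)), SD q i (n + 1) P → ∃ (m : ℕ) (Q : Pred (m + 1)),
    SD q' i' (m + 1) Q ∧ ∀ M, Prem s P M → Prem s' Q M ∧ ((∀ w, Q M w) → ∀ v, P M v)

theorem Translates.indRule (h : Translates s q i s' q' i') :
    IndRule s (strictClass q i) ≤ᵣ IndRule s' (strictClass q' i') :=
  reducible_of fun T M hM hS => by
    rw [sat_indRule] at hS ⊢
    intro n P hP hprem
    obtain ⟨m, Q, hQ, h⟩ := h P hP
    exact (h M (hprem M hM)).2 (hS Q hQ fun N hN => (h N (hprem N hN)).1)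

/-- Elimination of parameters. -/
theorem PFHolds.of_prem (h : PFHolds s q i M) {P : Pred (n + 1)} (hP : SD q i (n + 1) P)
    (hprem : Prem s P M) (w : Fin (n + 1) → M) : P M w := by
  have hQ : SD q i 1 fun M z =>
      P M (Fin.cons (low (z 0)) fun j : Fin n => low (rest^[j.val + 1] (z 0))) :=
    hP.cons (Rep.var 0).low fun j => ((Rep.var 0).iterate_rest _).low
  obtain ⟨z, hz⟩ := exists_code w
  have := h _ hQ (fun v => ⟨?_, fun x => ?_⟩) ![z]
  · convert this using 1
    ext j
    refine Fin.cases ?_ (fun j => ?_) j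
    · exact (hz 0).symm
    · exact (hz j.succ).symm
  · simp only [Fin.cons_zero, low_zero]
    exact (hprem _).1
  · cases s
    · simp only [Step, Fin.cons_zero, Function.iterate_succ_apply]
      intro hx
      rcases low_succ x with h | ⟨h, h'⟩
      -- When the low part is reset the coded parameters may change arbitrarily; this is harmless
      -- because the base case holds for all parameters.
      · rw [h]
        exact (hprem _).1
      · rw [h, h']
        exact (hprem _).2 _ hx
    · simp only [Step, Fin.cons_zero, Function.iterate_succ_apply]
      intro hx
      rcases low_hf x with h | ⟨h, h'⟩
      · rw [h]
        exact (hprem _).1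
      · rw [h, h'] at hx
        exact (hprem _).2 _ hx

theorem indRule_le_schemePF :
    IndRule s (strictClass q i) ≤ᵣ SchemePF s (strictClass q i) :=
  reducible_of fun T M hM hS => by
    rw [sat_schemePF] at hS
    rw [sat_indRule]
    exact fun n P hP hprem => hS.of_prem hP (hprem M hM)

/-- The translated predicate may have parameters even if the original has none; `PFHolds.of_prem`
removes them again. -/
theorem Translates.schemePF (h : Translates s q i s' q' i') :
    SchemePF s (strictClass q i) ≤ᵣ SchemePF s' (strictClass q' i') :=
  reducible_of fun T M hM hS => by
    rw [sat_schemePF] at hS ⊢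
    intro P hP hprem
    obtain ⟨m, Q, hQ, h⟩ := h P hP
    exact (h M hprem).2 (hS.of_prem hQ (h M hprem).1)

theorem schemePF_le_scheme (Γ : FormulaClass) : SchemePF s Γ ≤ᵣ Scheme s Γ :=
  reducible_of fun _ _ _ hS Δ ψ ⟨φ, hφ, h⟩ => hS Δ ψ ⟨0, φ, hφ, h⟩

theorem scheme_le_scheme (h : ∀ M, AxHolds s' q' i' M → AxHolds s q i M) :
    Scheme s (strictClass q i) ≤ᵣ Scheme s' (strictClass q' i') :=
  reducible_of fun _ M _ hS => sat_scheme.2 (h M (sat_scheme.1 hS))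

end Rules

/-! ### Reversed induction -/

section Reversal

variable {s : IndKind} {q : Quant} {i n : ℕ} {M : Model}

/-- The values `a ∸ x` and `⌊a/2^|x|⌋`, respectively, descending from `a` to `0`. -/
def descend : IndKind → M → M → M
  | .ind, a, x => a - x
  | .pind, a, x => ms a (ln x)

theorem descend_zero (a : M) : descend s a 0 = a := by
  cases s
  · exact tsub_zero a
  · rw [descend, ln_zero, ms_zero]

theorem descend_self (a : M) : descend s a a = 0 := by
  cases s
  · exact tsub_self a
  · exact ms_of_ln_le le_rfl

theorem Rep.descend {F G : Fam n} (hF : Rep F) (hG : Rep G) :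
    Rep fun M v => descend s (F M v) (G M v) := by
  cases s
  exacts [hF.sub hG, hF.ms hG.ln]

/-- Contraposition of the step for `p`. Once the descent has reached 0 under `a ∸ x`, `p 0` is used
instead. -/
theorem step_descend {p : M → Prop} (h0 : p 0) (hs : ∀ x, Step s p x) (a x : M) :
    Step s (fun x => ¬ p (descend s a x)) x := by
  cases s
  · simp only [Step, descend] at hs ⊢
    refine mt fun h => ?_
    rcases le_or_gt a x with hx | hx
    · rwa [sub_of_le hx]
    · have := hs _ h
      rwa [tsub_add_eq_tsub_tsub, sub_add_model (one_le_iff.2 (tsub_pos_of_lt hx))] at this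
  · simp only [Step, descend] at hs ⊢
    refine mt fun h => ?_
    by_cases hx : x = 0
    · rwa [hx, hf_zero, ← hx]
    · rw [ln_hf hx, ms_succ] at h
      exact hs _ h

/-- If `P(a)` failed, induction on the negation along the descent from `a` would refute `P(0)`. The
number `a` becomes a parameter. -/
theorem AxHolds.dual (h : AxHolds s q i M) : AxHolds s q.dual i M := by
  intro n P hP v h0 hs a
  have hQ : SD q i (n + 1 + 1) fun M w =>
      ¬ P M (Fin.cons (descend s (w 1) (w 0)) fun j => w j.succ.succ) :=
    (hP.cons ((Rep.var 1).descend (Rep.var 0)) fun j => Rep.var _).not'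
  by_contra ha
  refine h _ hQ (Fin.cons a v) ?_ (fun x => ?_) a ?_
  · simpa [descend_zero] using ha
  · exact step_descend h0 hs a x
  · simpa [descend_self] using h0

/-- A bounded universal quantifier block can be replaced by additional parameters. -/
theorem SD.exists_forall {P : Pred n} (hP : SD .pi i n P) :
    ∃ (N : ℕ) (e : Fin n → Fin N) (θ : Pred N), SD .sigma i N θ ∧
      ∀ M v, P M v ↔ ∀ w : Fin N → M, w ∘ e = v → θ M w := by
  cases i with
  | zero => exact ⟨n, id, P, hP, fun M v => by simp⟩
  | succ i =>
    simp only [SD] at hP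
    induction hP with
    | base h => exact ⟨_, id, _, SD.succ h, fun _ _ => by simp⟩
    | @quant n P g _ ih =>
      obtain ⟨N, e, θ, hθ, h⟩ := ih
      -- The variable at position `e 0` is freed, and its bound is moved into the matrix.
      refine ⟨N, e ∘ Fin.succ, fun M w => ¬ w (e 0) ≤ ev g (w ∘ e ∘ Fin.succ) ∨ θ M w, ?_, ?_⟩
      · exact (SD.le (Rep.var (e 0)) ((Rep.ev g).subst fun j => Rep.var (e j.succ))).not'.or hθ
      · intro M v
        simp only [bq, h]
        constructor
        · rintro h w rfl
          rw [← imp_iff_not_or]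
          refine fun hw => h _ hw w ?_
          ext j
          refine Fin.cases ?_ (fun j => ?_) j <;> rfl
        · intro h x hx w hw
          have hx' : w (e 0) = x := congrFun hw 0
          have hv : w ∘ e ∘ Fin.succ = v := funext fun j => congrFun hw j.succ
          refine (h w hv).resolve_left (not_not.2 ?_)
          rwa [hx', hv]

/-- Writing `P` as `∀ w θ`, the induction formula is `θ ∨ ¬ P(descend a x)`, with `θ` independent of
`x`. At `x = 0` it says that `P(a)` implies its instance `θ`; the step is the reversed step for `P`;
at `x = a` it yields `θ`, since `P(0)` holds. As `w` is arbitrary, `P(a)` follows. -/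
theorem translates_pi_sigma : Translates s .pi i s .sigma i := by
  intro n P hP
  obtain ⟨N, e, θ, hθ, h⟩ := hP.exists_forall
  refine ⟨N, fun M w => θ M (fun j => w j.succ) ∨
    ¬ P M (Fin.cons (descend s (w (e 0).succ) (w 0)) fun j => w (e j.succ).succ), ?_, ?_⟩
  · exact hθ.weaken.or
      (SD.not (q := .pi) (hP.cons ((Rep.var _).descend (Rep.var _)) fun _ => Rep.var _))
  · refine fun M hprem => ⟨fun v => ⟨?_, fun x => ?_⟩, fun hQ v => (h M v).2 ?_⟩
    · simp only [Fin.cons_succ, Fin.cons_zero, descend_zero]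
      rw [← imp_iff_or_not]
      refine fun hPv => (h M _).1 hPv v ?_
      ext j
      refine Fin.cases ?_ (fun j => ?_) j <;> rfl
    · have := step_descend (hprem fun j => v (e j.succ)).1 (hprem fun j => v (e j.succ)).2
        (v (e 0)) x
      cases s <;> exact Or.imp_right this
    · rintro w -
      have := hQ (Fin.cons (w (e 0)) w)
      simp only [Fin.cons_succ, Fin.cons_zero, descend_self] at this
      exact this.resolve_right (not_not.2 (hprem _).1)

end Reversal

/-! ### Polynomial induction from induction -/

section PolynomialInduction

variable {q : Quant} {i n : ℕ} {M : Model}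

/-- The predicate `P(⌊a/2^(|a| ∸ x)⌋, v)` of `x, a, v`. -/
def prefixPred (P : Pred (n + 1)) : Pred (n + 1 + 1) := fun _ w =>
  P _ (Fin.cons (ms (w 1) (ln (w 1) - w 0)) fun j => w j.succ.succ)

theorem SD.prefixPred {P : Pred (n + 1)} (hP : SD q i (n + 1) P) :
    SD q i (n + 1 + 1) (prefixPred P) :=
  hP.cons ((Rep.var 1).ms ((Rep.var 1).ln.sub (Rep.var 0))) fun _ => Rep.var _

theorem prefixPred_zero {P : Pred (n + 1)} {a : M} {v : Fin n → M} :
    prefixPred P M (Fin.cons 0 (Fin.cons a v)) ↔ P M (Fin.cons 0 v) := by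
  simp [prefixPred, ms_of_ln_le]

theorem prefixPred_ln {P : Pred (n + 1)} {a : M} {v : Fin n → M} :
    prefixPred P M (Fin.cons (ln a) (Fin.cons a v)) ↔ P M (Fin.cons a v) := by
  simp [prefixPred, ms_zero]

/-- Increasing `x` by 1 appends one more bit of `a` to the prefix, or changes nothing once the
prefix is all of `a`. -/
theorem step_prefixPred {P : Pred (n + 1)} {a : M} {v : Fin n → M}
    (hs : ∀ x, Step .pind (fun x => P M (Fin.cons x v)) x) (x : M) :
    Step .ind (fun x => prefixPred P M (Fin.cons x (Fin.cons a v))) x := by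
  simp only [Step, prefixPred, Fin.cons_zero, Fin.cons_one, Fin.cons_succ] at hs ⊢
  intro hx
  rcases ms_sub_succ a (ln a) x with h | h <;> rw [h] at hx
  exacts [hx, hs _ hx]

theorem AxHolds.pind (h : AxHolds .ind q i M) : AxHolds .pind q i M := fun _ _ hP _ h0 hs a =>
  prefixPred_ln.1 (h _ hP.prefixPred _ (prefixPred_zero.2 h0) (step_prefixPred hs) (ln a))

theorem translates_pind_ind : Translates .pind q i .ind q i := by
  intro n P hP
  refine ⟨_, _, hP.prefixPred, fun M hprem => ⟨?_, fun hQ => ?_⟩⟩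
  · refine fun v => ?_
    rw [← Fin.cons_self_tail v]
    exact ⟨prefixPred_zero.2 (hprem _).1, step_prefixPred (hprem _).2⟩
  · exact forall_cons_iff.1 fun v a => prefixPred_ln.1 (hQ _)

end PolynomialInduction

/-! ### Induction from polynomial induction -/

section BinarySearch

variable {i n : ℕ} {M : Model}

/-- The minimum of `u` and `a`. -/
def trunc (a u : M) : M := a - (a - u)

theorem Rep.trunc {F G : Fam n} (hF : Rep F) (hG : Rep G) :
    Rep fun M v => trunc (F M v) (G M v) := hF.sub (hF.sub hG)

theorem trunc_of_le {a u : M} (h : u ≤ a) : trunc a u = u := tsub_tsub_cancel_of_le h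

theorem trunc_of_ge {a u : M} (h : a ≤ u) : trunc a u = a := by
  rw [trunc, sub_of_le h, tsub_zero]

theorem trunc_le (a u : M) : trunc a u ≤ a := tsub_le_self

theorem trunc_succ {p : M → Prop} (hp : ∀ x, p x → p (x + 1)) {a u : M} (h : p (trunc a u)) :
    p (trunc a (u + 1)) := by
  rcases lt_or_ge u a with hu | hu
  · rw [trunc_of_le hu.le] at h
    rw [trunc_of_le (succ_le_iff.2 hu)]
    exact hp _ h
  · rw [trunc_of_ge hu] at h
    rwa [trunc_of_ge (hu.trans le_self_add)]

theorem trunc_trunc_add (a u x : M) : trunc a (trunc a u + x) = trunc a (u + x) := by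
  rcases le_total u a with hu | hu
  · rw [trunc_of_le hu]
  · rw [trunc_of_ge hu, trunc_of_ge le_self_add, trunc_of_ge (hu.trans le_self_add)]

/-- Either `P(0)` fails, or `P(a)` holds, or there is an interval of length `2^(|a| ∸ |x|)` such
that `P` holds at its left end and fails at its right end. -/
def searchPred (P : Pred (n + 1)) : Pred (n + 1 + 1) := fun M w =>
  (¬ P M (Fin.cons 0 fun j => w j.succ.succ) ∨ P M (Fin.cons (w 1) fun j => w j.succ.succ)) ∨
    ∃ u ≤ w 1, P M (Fin.cons (trunc (w 1) u) fun j => w j.succ.succ) ∧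
      ¬ P M (Fin.cons (trunc (w 1) (u + pw (ms (w 1) (ln (w 0))))) fun j => w j.succ.succ)

theorem SD.searchPred {P : Pred (n + 1)} (hP : SD .sigma i (n + 1) P) :
    SD .sigma (i + 1) (n + 1 + 1) (searchPred P) := by
  refine ((hP.cons Rep.zero fun j => Rep.var _).not.lift.or
    (hP.cons (Rep.var 1) fun j => Rep.var _).lift).or (SD.bex (Rep.var 1) (P := fun M w =>
      P M (Fin.cons (TC0Arith.trunc (w 2) (w 0)) fun j => w j.succ.succ.succ) ∧
      ¬ P M (Fin.cons (TC0Arith.trunc (w 2) (w 0 + TC0Arith.pw (TC0Arith.ms (w 2) (TC0Arith.ln (w 1)))))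
        fun j => w j.succ.succ.succ)) ?_)
  exact (hP.cons ((Rep.var 2).trunc (Rep.var 0)) fun j => Rep.var _).lift.and
    (hP.cons ((Rep.var 2).trunc ((Rep.var 0).add ((Rep.var 2).ms (Rep.var 1).ln).pw))
      fun j => Rep.var _).not.lift

/-- One round of binary search, valid in every model with no assumption on `P`; hence the rule
applies over any `T` and yields a full scheme. Passing from `⌊x/2⌋` to `x ≠ 0` lengthens `x` by one
bit, which halves the interval. -/
theorem prem_searchPred (P : Pred (n + 1)) : Prem .pind (searchPred P) M := by
  intro v
  rw [← Fin.cons_self_tail v]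
  generalize v 0 = a
  generalize Fin.tail v = v
  refine ⟨?_, fun x => ?_⟩
  · simp only [searchPred, Fin.cons_zero, Fin.cons_one, Fin.cons_succ, ln_zero, ms_zero]
    by_cases h : ¬ P M (Fin.cons 0 v) ∨ P M (Fin.cons a v)
    · exact .inl h
    · push Not at h
      refine .inr ⟨0, zero_le, ?_, ?_⟩
      · rw [trunc_of_le zero_le]
        exact h.1
      · rw [zero_add, trunc_of_ge (lt_pw a).le]
        exact h.2
  · simp only [Step, searchPred, Fin.cons_zero, Fin.cons_one, Fin.cons_succ]
    refine Or.imp_right ?_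
    rintro ⟨u, hu, h, h'⟩
    by_cases hx : x = 0
    · rw [hx, hf_zero, ← hx] at h'
      exact ⟨u, hu, h, h'⟩
    rw [ln_hf hx, ms_succ]
    generalize ms a (ln (hf x)) = m at *
    -- The interval already has length 1 and cannot be halved further.
    by_cases hm : m = 0
    · rw [hm, hf_zero, ← hm]
      exact ⟨u, hu, h, h'⟩
    -- The value of `P` at the midpoint decides which half is kept.
    by_cases hmid : P M (Fin.cons (trunc a (u + pw (hf m))) v)
    · refine ⟨trunc a (u + pw (hf m)), trunc_le _ _, ?_, ?_⟩
      · rwa [trunc_of_le (trunc_le _ _)]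
      · rwa [trunc_trunc_add, add_assoc, ← two_mul, ← pw_hf hm]
    · exact ⟨u, hu, h, hmid⟩

theorem scheme_ind_le_indRule_pind :
    Scheme .ind (strictClass .sigma i) ≤ᵣ IndRule .pind (strictClass .sigma (i + 1)) :=
  reducible_of fun T M _ hS => by
    rw [sat_indRule] at hS
    rw [sat_scheme]
    intro n P hP v h0 hs a
    -- At `x = a` the interval has length `2^0 = 1`, so its endpoints would violate the induction
    -- step for `P`.
    have := hS _ hP.searchPred (fun N _ => prem_searchPred P) (Fin.cons a (Fin.cons a v))
    simp only [searchPred, Fin.cons_zero, Fin.cons_one, Fin.cons_succ] at this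
    rcases this with (h | h) | ⟨u, -, h, h'⟩
    · exact absurd h0 h
    · exact h
    · rw [ms_of_ln_le le_rfl, pw_zero] at h'
      exact absurd (trunc_succ (p := fun x => P M (Fin.cons x v)) hs h) h'

/-- The predicate `∀ u ≤ a, P(u) → P(min(u + x, a))` of `x, a`. -/
def shiftPred (P : Pred (n + 1)) : Pred (n + 1 + 1) := fun M w =>
  ∀ u ≤ w 1, ¬ P M (Fin.cons u fun j => w j.succ.succ) ∨
    P M (Fin.cons (trunc (w 1) (u + w 0)) fun j => w j.succ.succ)

theorem SD.shiftPred {P : Pred (n + 1)} (hP : SD .sigma i (n + 1) P) :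
    SD .pi (i + 1) (n + 1 + 1) (shiftPred P) := by
  refine SD.ball (Rep.var 1) (P := fun M w =>
      ¬ P M (Fin.cons (w 0) fun j => w j.succ.succ.succ) ∨
      P M (Fin.cons (TC0Arith.trunc (w 2) (w 0 + w 1)) fun j => w j.succ.succ.succ)) ?_
  exact (hP.cons (Rep.var 0) fun j => Rep.var _).not.lift.or
    (hP.cons ((Rep.var 2).trunc ((Rep.var 0).add (Rep.var 1))) fun j => Rep.var _).lift

/-- A shift by `⌊x/2⌋` that preserves `P` from every `u ≤ a` can be applied twice, and one more unit
step covers odd `x`. Truncating at `a` keeps the intermediate point within the range of `u`. -/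
theorem translates_ind_pind : Translates .ind .sigma i .pind .pi (i + 1) := by
  intro n P hP
  refine ⟨_, _, hP.shiftPred, fun M hprem => ⟨fun v => ?_, fun hQ => ?_⟩⟩
  · rw [← Fin.cons_self_tail v]
    generalize v 0 = a
    generalize Fin.tail v = v
    have hs := (hprem v).2
    simp only [Step, shiftPred, Fin.cons_zero, Fin.cons_one, Fin.cons_succ, ← imp_iff_not_or]
      at hs ⊢
    refine ⟨fun u hu h => by rwa [add_zero, trunc_of_le hu], fun x ih u hu h => ?_⟩
    have h₁ := ih _ (trunc_le _ _) (ih u hu h)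
    rw [trunc_trunc_add, add_assoc, ← two_mul] at h₁
    rcases two_mul_hf x with hx | hx
    · rwa [hx] at h₁
    · rw [← hx, ← add_assoc]
      exact trunc_succ (p := fun x => P M (Fin.cons x v)) hs h₁
  · refine forall_cons_iff.1 fun v a => ?_
    -- Shifting `u = 0` by `x = a` carries `P(0)` to `P(a)`.
    have := hQ (Fin.cons a (Fin.cons a v)) 0 zero_le
    simp only [Fin.cons_zero, Fin.cons_one, Fin.cons_succ, zero_add, trunc_of_le le_rfl] at this
    exact this.resolve_left (not_not.2 (hprem v).1)

end BinarySearch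

end TC0Arith

/-! ### Assembling the reductions -/

open TC0Arith
theorem theorem3p3 (i : ℕ) :
    -- rules reduce to parameter-free schemes, which reduce to schemes with parameters
    (∀ Γ : FormulaClass, Γ = SigmaHat i ∨ Γ = PiHat i → ∀ s : IndKind,
      IndRule s Γ ≤ᵣ SchemePF s Γ ∧ SchemePF s Γ ≤ᵣ Scheme s Γ) ∧
    (∀ s : IndKind, Scheme s (SigmaHat i) ≡ᵣ Scheme s (PiHat i)) ∧
    (∀ s : IndKind, SchemePF s (PiHat i) ≤ᵣ SchemePF s (SigmaHat i) ∧
      IndRule s (PiHat i) ≤ᵣ IndRule s (SigmaHat i)) ∧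
    -- polynomial induction reduces to induction
    (∀ Γ : FormulaClass, Γ = SigmaHat i ∨ Γ = PiHat i →
      Scheme .pind Γ ≤ᵣ Scheme .ind Γ ∧
      SchemePF .pind Γ ≤ᵣ SchemePF .ind Γ ∧
      IndRule .pind Γ ≤ᵣ IndRule .ind Γ) ∧
    Scheme .ind (SigmaHat i) ≤ᵣ IndRule .pind (SigmaHat (i + 1)) ∧
    (SchemePF .ind (SigmaHat i) ≤ᵣ SchemePF .pind (PiHat (i + 1)) ∧
      IndRule .ind (SigmaHat i) ≤ᵣ IndRule .pind (PiHat (i + 1))) := by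
  have hΓ : ∀ Γ : FormulaClass, Γ = SigmaHat i ∨ Γ = PiHat i → ∃ q, Γ = strictClass q i := by
    rintro Γ (rfl | rfl)
    exacts [⟨.sigma, rfl⟩, ⟨.pi, rfl⟩]
  refine ⟨fun Γ h s => ?_, fun s => ⟨?_, ?_⟩, fun s => ⟨?_, ?_⟩, fun Γ h => ?_,
    scheme_ind_le_indRule_pind, translates_ind_pind.schemePF, translates_ind_pind.indRule⟩
  · obtain ⟨q, rfl⟩ := hΓ Γ h
    exact ⟨indRule_le_schemePF, schemePF_le_scheme _⟩
  · exact scheme_le_scheme (q := .sigma) (q' := .pi) fun _ h => h.dual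
  · exact scheme_le_scheme (q := .pi) (q' := .sigma) fun _ h => h.dual
  · exact translates_pi_sigma.schemePF
  · exact translates_pi_sigma.indRule
  · obtain ⟨q, rfl⟩ := hΓ Γ h
    exact ⟨scheme_le_scheme fun _ h => h.pind, translates_pind_ind.schemePF,
      translates_pind_ind.indRule⟩
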